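/- Let $\mathcal G$ be an étale groupoid, not necessarily Hausdorff, with locally compact Hausdorff unit space $\mathcal G^{(0)}$ (so the source and range maps $\mathsf s,\mathsf r\colon\mathcal G\to\mathcal G^{(0)}$ are local homeomorphisms), and let $c\colon\mathcal G\to\mathbb Z$ be a continuous cocycle. Put $\mathcal G_n=c^{-1}(n)$; then $\mathcal G_0$ is an open subgroupoid of $\mathcal G$ and is itself étale. Let $C_c(\mathcal G)$ be the $*$-algebra, under convolution and $f^*(g)=\overline{f(g^{-1})}$, spanned by the functions $f\colon\mathcal G\to\mathbb C$ for which there is an open bisection $U$ such that $f|_U$ is continuous with compact support and $f$ vanishes outside $U$. For $x\in\mathcal G^{(0)}$ let $\lambda_x$ be the representation of $C_c(\mathcal G)$ on $\ell^2(\mathsf s^{-1}(x))$ by left convolution, and let $C^*_r(\mathcal G)$ be the completion of $C_c(\mathcal G)$ in the norm $\|f\|=\sup_x\|\lambda_x(f)\|$. The gauge action $T\colon\mathbb T\to\mathrm{Aut}(C^*_r(\mathcal G))$ is the action that extends the maps $T_z\colon C_c(\mathcal G)\to C_c(\mathcal G)$, $T_z(f)(\gamma)=z^{c(\gamma)}f(\gamma)$.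 An element $a\in C^*_r(\mathcal G)$ is regarded as the function $a(\gamma)=\langle\lambda_x(a)\delta_x,\delta_\gamma\rangle$ on $\mathcal G$, where $x=\mathsf s(\gamma)$. Then \[C^*_r(\mathcal G)^{\mathbb T}=C^*_r(\mathcal G_0).\] That is, the fixed-point algebra $\{a\in C^*_r(\mathcal G): T_z(a)=a\text{ for all }z\in\mathbb T\}$ is the closure in $C^*_r(\mathcal G)$ of $C_c(\mathcal G_0)$ (functions on $\mathcal G_0$ extended by zero), and the extension by zero $C_c(\mathcal G_0)\to C_c(\mathcal G)$ extends to an isometric $*$-homomorphism $C^*_r(\mathcal G_0)\to C^*_r(\mathcal G)$ whose image is $C^*_r(\mathcal G)^{\mathbb T}$. In particular, every $a\in C^*_r(\mathcal G)^{\mathbb T}$ is supported on $\mathcal G_0$, that is, $a(\gamma)=0$ for all $\gamma\in\mathcal G\setminus\mathcal G_0$. -/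

import Mathlib

open CategoryTheory Topology
open scoped ENNReal NNReal

universe u v

set_option linter.unusedSectionVars false

noncomputable section

namespace EtaleGroupoid

section Kernel

variable {ι : Type*}

/-- The Hilbert space `ℓ²(ι)` of square-summable complex functions on `ι`. -/
abbrev Ell2 (ι : Type*) : Type _ := lp (fun _ : ι => ℂ) 2

/-- The basis vector `δ_i` of `ℓ²(ι)`. -/
def delta (i : ι) : Ell2 ι :=
  letI := Classical.decEq ι
  lp.single 2 i (1 : ℂ)

/-- The rows and the columns of the matrix `k` are absolutely summable with sums at most `M`. -/
structure SchurBound (k : ι → ι → ℂ) (M : ℝ≥0) : Prop where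
  row : ∀ i, ∑' j, ‖k i j‖ₑ ≤ M
  col : ∀ j, ∑' i, ‖k i j‖ₑ ≤ M

theorem ennreal_two_mul_le (x y : ℝ≥0∞) : 2 * (x * y) ≤ x ^ 2 + y ^ 2 := by
  by_cases hx : x = ∞
  · simp [hx]
  by_cases hy : y = ∞
  · simp [hy]
  lift x to ℝ≥0 using hx
  lift y to ℝ≥0 using hy
  rw [← mul_assoc]
  exact_mod_cast two_mul_le_add_sq x y

theorem ennreal_cauchy_schwarz (a x : ι → ℝ≥0∞) :
    (∑' j, a j * x j) ^ 2 ≤ (∑' j, a j) * ∑' j, a j * x j ^ 2 := by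
  have h1 : (∑' j, a j * x j) ^ 2 = ∑' j, ∑' l, a j * a l * (x j * x l) := by
    rw [sq, ← ENNReal.tsum_mul_right]
    refine tsum_congr fun j => ?_
    rw [← ENNReal.tsum_mul_left]
    exact tsum_congr fun l => by ring
  have h2 : (∑' j, a j) * ∑' j, a j * x j ^ 2 = ∑' j, ∑' l, a j * a l * x l ^ 2 := by
    rw [← ENNReal.tsum_mul_right]
    refine tsum_congr fun j => ?_
    rw [← ENNReal.tsum_mul_left]
    exact tsum_congr fun l => by ring
  have h3 : (∑' j, a j) * ∑' j, a j * x j ^ 2 = ∑' j, ∑' l, a j * a l * x j ^ 2 := by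
    rw [h2, ENNReal.tsum_comm]
    exact tsum_congr fun l => tsum_congr fun j => by ring
  have h4 : 2 * (∑' j, a j * x j) ^ 2 ≤ 2 * ((∑' j, a j) * ∑' j, a j * x j ^ 2) := by
    rw [two_mul (_ * _)]
    nth_rw 1 [h3]
    rw [h2, h1, ← ENNReal.tsum_mul_left, ← ENNReal.tsum_add]
    refine ENNReal.tsum_le_tsum fun j => ?_
    rw [← ENNReal.tsum_mul_left, ← ENNReal.tsum_add]
    refine ENNReal.tsum_le_tsum fun l => ?_
    calc 2 * (a j * a l * (x j * x l)) = a j * a l * (2 * (x j * x l)) := by ring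
      _ ≤ a j * a l * (x j ^ 2 + x l ^ 2) := by gcongr; exact ennreal_two_mul_le _ _
      _ = _ := by ring
  exact (ENNReal.mul_le_mul_iff_right (by simp) (by simp)).1 h4

theorem SchurBound.tsum_le {k : ι → ι → ℂ} {M : ℝ≥0} (hk : SchurBound k M) (ξ : ι → ℂ) :
    ∑' i, ‖∑' j, k i j * ξ j‖ₑ ^ 2 ≤ M ^ 2 * ∑' j, ‖ξ j‖ₑ ^ 2 := by
  calc ∑' i, ‖∑' j, k i j * ξ j‖ₑ ^ 2
      ≤ ∑' i, M * ∑' j, ‖k i j‖ₑ * ‖ξ j‖ₑ ^ 2 := by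
        refine ENNReal.tsum_le_tsum fun i => ?_
        calc ‖∑' j, k i j * ξ j‖ₑ ^ 2 ≤ (∑' j, ‖k i j‖ₑ * ‖ξ j‖ₑ) ^ 2 := by
              gcongr
              refine (enorm_tsum_le_tsum_enorm).trans_eq (tsum_congr fun j => ?_)
              rw [enorm_mul]
          _ ≤ _ := ennreal_cauchy_schwarz _ _
          _ ≤ _ := by gcongr; exact hk.row i
    _ = M * ∑' j, (∑' i, ‖k i j‖ₑ) * ‖ξ j‖ₑ ^ 2 := by
        rw [ENNReal.tsum_mul_left, ENNReal.tsum_comm]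
        simp_rw [ENNReal.tsum_mul_right]
    _ ≤ M * ∑' j, M * ‖ξ j‖ₑ ^ 2 := by
        gcongr with j
        exact hk.col j
    _ = _ := by rw [ENNReal.tsum_mul_left, sq, mul_assoc]

theorem memlp_two_iff (ξ : ι → ℂ) : Memℓp ξ 2 ↔ ∑' j, ‖ξ j‖ₑ ^ 2 ≠ ∞ := by
  rw [memℓp_gen_iff (by simp)]
  have : ∀ j, ‖ξ j‖ₑ ^ 2 = ((‖ξ j‖₊ ^ 2 : ℝ≥0) : ℝ≥0∞) := fun j => by
    rw [enorm_eq_nnnorm]; push_cast; rfl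
  simp_rw [this]
  rw [ENNReal.tsum_coe_ne_top_iff_summable, ← NNReal.summable_coe]
  simp

theorem enorm_sq_eq_tsum (ξ : Ell2 ι) : ‖ξ‖ₑ ^ 2 = ∑' j, ‖ξ j‖ₑ ^ 2 := by
  have h := lp.hasSum_norm (p := 2) (by simp) ξ
  have h' : HasSum (fun j => ((‖ξ j‖₊ ^ 2 : ℝ≥0) : ℝ)) ((‖ξ‖₊ ^ 2 : ℝ≥0) : ℝ) := by
    simpa using h
  have h2 := ENNReal.hasSum_coe.2 (NNReal.hasSum_coe.1 h')
  have := h2.tsum_eq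
  simp only [ENNReal.coe_pow, ← enorm_eq_nnnorm] at this
  exact this.symm

theorem SchurBound.summable {k : ι → ι → ℂ} {M : ℝ≥0} (hk : SchurBound k M) (ξ : Ell2 ι) (i : ι) :
    Summable fun j => k i j * ξ j := by
  have h1 : Summable fun j => ‖k i j‖ := by
    have := (hk.row i).trans_lt ENNReal.coe_lt_top
    simp_rw [enorm_eq_nnnorm] at this
    exact NNReal.summable_coe.2 (ENNReal.tsum_coe_ne_top_iff_summable.1 this.ne)
  refine Summable.of_norm_bounded (h1.mul_right ‖ξ‖) fun j => ?_
  rw [norm_mul]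
  gcongr
  exact lp.norm_apply_le_norm (by simp) ξ j

theorem SchurBound.norm_le {k : ι → ι → ℂ} {M : ℝ≥0} (hk : SchurBound k M) (ξ η : Ell2 ι)
    (h : ∀ i, η i = ∑' j, k i j * ξ j) : ‖η‖ ≤ M * ‖ξ‖ := by
  have h1 := hk.tsum_le ξ
  simp_rw [← h] at h1
  rw [← enorm_sq_eq_tsum, ← enorm_sq_eq_tsum, ← mul_pow] at h1
  have h2 := (ENNReal.pow_le_pow_left_iff two_ne_zero).1 h1
  rw [enorm_eq_nnnorm, enorm_eq_nnnorm] at h2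
  exact_mod_cast h2

/-- The bounded operator on `ℓ²(ι)` with matrix `k`, i.e. `(k ξ)(i) = ∑_j k(i,j) ξ(j)`. -/
def kernelOp (k : ι → ι → ℂ) (hk : ∃ M, SchurBound k M) : Ell2 ι →L[ℂ] Ell2 ι :=
  LinearMap.mkContinuousOfExistsBound
    { toFun := fun ξ => ⟨fun i => ∑' j, k i j * ξ j, by
        obtain ⟨M, hM⟩ := hk
        change Memℓp _ 2
        rw [memlp_two_iff]
        refine ((hM.tsum_le ξ).trans_lt ?_).ne
        rw [← enorm_sq_eq_tsum]
        exact ENNReal.mul_lt_top (by simp) (by simp)⟩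
      map_add' := fun ξ η => by
        obtain ⟨M, hM⟩ := hk
        ext i
        simp only [lp.coeFn_add, Pi.add_apply, mul_add]
        exact (hM.summable ξ i).tsum_add (hM.summable η i)
      map_smul' := fun a ξ => by
        ext i
        simp only [lp.coeFn_smul, Pi.smul_apply, smul_eq_mul, RingHom.id_apply]
        rw [← tsum_mul_left]
        exact tsum_congr fun j => by ring }
    (by
      obtain ⟨M, hM⟩ := hk
      refine ⟨M, fun ξ => ?_⟩
      exact hM.norm_le ξ _ fun i => rfl)

theorem kernelOp_apply (k : ι → ι → ℂ) (hk : ∃ M, SchurBound k M) (ξ : Ell2 ι) (i : ι) :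
    kernelOp k hk ξ i = ∑' j, k i j * ξ j := rfl

theorem kernelOp_norm_le {k : ι → ι → ℂ} {M : ℝ≥0} (hM : SchurBound k M) (hk : ∃ M, SchurBound k M) :
    ‖kernelOp k hk‖ ≤ M :=
  ContinuousLinearMap.opNorm_le_bound _ M.2 fun ξ => hM.norm_le ξ _ fun _ => rfl

theorem delta_self (i : ι) : delta i i = 1 := by
  simp [delta]

theorem delta_ne {i j : ι} (h : j ≠ i) : delta i j = 0 := by
  simp [delta, h]

theorem inner_delta (i : ι) (ξ : Ell2 ι) : inner ℂ (delta i) ξ = ξ i := by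
  classical
  unfold delta
  rw [lp.inner_single_left]
  simp

theorem kernelOp_delta (k : ι → ι → ℂ) (hk : ∃ M, SchurBound k M) (i j : ι) :
    kernelOp k hk (delta j) i = k i j := by
  classical
  rw [kernelOp_apply, tsum_eq_single j]
  · simp [delta_self]
  · intro l hl
    simp [delta_ne hl]

/-- A bounded operator on `ℓ²(ι)` is determined by its matrix coefficients. -/
theorem op_ext {A B : Ell2 ι →L[ℂ] Ell2 ι} (h : ∀ i j, A (delta j) i = B (delta j) i) : A = B := by
  classical
  refine lp.ext_continuousLinearMap (by simp) fun j => ?_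
  ext i
  simpa [delta] using h i j

theorem kernelOp_eq_iff (k : ι → ι → ℂ) (hk : ∃ M, SchurBound k M) (A : Ell2 ι →L[ℂ] Ell2 ι) :
    A = kernelOp k hk ↔ ∀ i j, A (delta j) i = k i j := by
  constructor
  · rintro rfl i j
    exact kernelOp_delta k hk i j
  · intro h
    exact op_ext fun i j => by rw [h, kernelOp_delta]

theorem kernelOp_mul {k₁ k₂ k : ι → ι → ℂ} (h₁ : ∃ M, SchurBound k₁ M) (h₂ : ∃ M, SchurBound k₂ M)
    (h : ∃ M, SchurBound k M) (hk : ∀ i j, k i j = ∑' l, k₁ i l * k₂ l j) :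
    kernelOp k₁ h₁ * kernelOp k₂ h₂ = kernelOp k h := by
  rw [kernelOp_eq_iff]
  intro i j
  change kernelOp k₁ h₁ (kernelOp k₂ h₂ (delta j)) i = _
  rw [kernelOp_apply, hk]
  simp_rw [kernelOp_delta]

theorem kernelOp_star {k k' : ι → ι → ℂ} (h : ∃ M, SchurBound k M) (h' : ∃ M, SchurBound k' M)
    (hk : ∀ i j, k' i j = star (k j i)) : star (kernelOp k h) = kernelOp k' h' := by
  rw [kernelOp_eq_iff]
  intro i j
  rw [← inner_delta, ContinuousLinearMap.star_eq_adjoint, ContinuousLinearMap.adjoint_inner_right,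
    ← inner_conj_symm, inner_delta, kernelOp_delta, hk]
  rfl

end Kernel

section Groupoid

/-- The arrow space `𝒢` of a groupoid with unit space `X`. -/
@[ext]
structure Arr (X : Type u) [Groupoid.{v} X] : Type (max u v) where
  src : X
  tgt : X
  hom : src ⟶ tgt

variable {X : Type u} [Groupoid.{v} X]

namespace Arr

/-- The identity arrow at `x`. -/
def unit (x : X) : Arr X := ⟨x, x, 𝟙 x⟩

/-- The inverse arrow. -/
def inv (g : Arr X) : Arr X := ⟨g.tgt, g.src, Groupoid.inv g.hom⟩

/-- The product `g h`, defined when `s(g) = r(h)`: first `h`, then `g`. -/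
def mul (g h : Arr X) (w : g.src = h.tgt) : Arr X :=
  ⟨h.src, g.tgt, h.hom ≫ eqToHom w.symm ≫ g.hom⟩

theorem mul_mk {x y z : X} (g : y ⟶ z) (h : x ⟶ y) :
    mul ⟨y, z, g⟩ ⟨x, y, h⟩ rfl = ⟨x, z, h ≫ g⟩ := by
  simp [mul]

theorem inv_inv (g : Arr X) : g.inv.inv = g := by
  simp [inv]

end Arr

/-- The source fibre `𝒢_x = s⁻¹(x)`. -/
abbrev Fiber (x : X) : Type (max u v) := Σ y : X, (x ⟶ y)

/-- An element of the source fibre `𝒢_x` as an element of `𝒢`. -/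
def Fiber.toArr {x : X} (g : Fiber x) : Arr X := ⟨x, g.1, g.2⟩

/-- The product `g h⁻¹` of `g, h ∈ 𝒢_x`. -/
def Fiber.div {x : X} (g h : Fiber x) : Arr X := ⟨h.1, g.1, Groupoid.inv h.2 ≫ g.2⟩

/-- The unit `x` as an element of `𝒢_x`. -/
def Fiber.unit (x : X) : Fiber x := ⟨x, 𝟙 x⟩

/-- An arrow as an element of its source fibre. -/
def Arr.toFiber (g : Arr X) : Fiber g.src := ⟨g.tgt, g.hom⟩

theorem Fiber.div_right_injective {x : X} {g h h' : Fiber x} (H : g.div h = g.div h') :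
    h = h' := by
  obtain ⟨y, g⟩ := g
  obtain ⟨z, h⟩ := h
  obtain ⟨z', h'⟩ := h'
  simp only [Fiber.div, Arr.mk.injEq] at H
  obtain ⟨rfl, -, H⟩ := H
  have H := eq_of_heq H
  simp only [Groupoid.inv_eq_inv, cancel_mono] at H
  rw [IsIso.inv_eq_inv.1 H]

theorem Fiber.div_left_injective {x : X} {g g' h : Fiber x} (H : g.div h = g'.div h) :
    g = g' := by
  obtain ⟨y, g⟩ := g
  obtain ⟨y', g'⟩ := g'
  obtain ⟨z, h⟩ := h
  simp only [Fiber.div, Arr.mk.injEq] at H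
  obtain ⟨-, rfl, H⟩ := H
  have H := eq_of_heq H
  simp only [cancel_epi] at H
  rw [H]

theorem Fiber.inv_div {x : X} (g h : Fiber x) : (g.div h).inv = h.div g := by
  simp [Fiber.div, Arr.inv]

theorem Arr.toFiber_div_unit (g : Arr X) : g.toFiber.div (Fiber.unit g.src) = g := by
  simp [Fiber.div, Fiber.unit, Arr.toFiber]

/-- The bijection `l ↦ l h⁻¹` from `𝒢_x` to `𝒢_{r(h)}`. -/
def Fiber.divEquiv {x : X} (h : Fiber x) : Fiber x ≃ Fiber h.1 where
  toFun l := ⟨l.1, Groupoid.inv h.2 ≫ l.2⟩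
  invFun m := ⟨m.1, h.2 ≫ m.2⟩
  left_inv l := by simp
  right_inv m := by simp

/-- The convolution product. Writing `g₁ g₂ = g` as `g₁ = g h⁻¹` and `g₂ = h`, the sum over all
factorizations of `g` is a sum over `h ∈ 𝒢_{s(g)}`. -/
def convolve (f₁ f₂ : Arr X → ℂ) (g : Arr X) : ℂ :=
  ∑' h : Fiber g.src, f₁ (g.toFiber.div h) * f₂ h.toArr

/-- The involution `f*(g) = conj (f (g⁻¹))`. -/
def involution (f : Arr X → ℂ) (g : Arr X) : ℂ := star (f g.inv)

variable [TopologicalSpace X] [TopologicalSpace (Arr X)]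

variable (X) in
/-- A topological groupoid: multiplication and inversion are continuous, and the unit space `X`
carries the topology of the set of identity arrows. -/
class IsTopologicalGroupoid : Prop where
  isInducing_unit : IsInducing (Arr.unit : X → Arr X)
  continuous_inv : Continuous (Arr.inv : Arr X → Arr X)
  continuous_mul : Continuous fun p : {p : Arr X × Arr X // p.1.src = p.2.tgt} =>
    Arr.mul p.1.1 p.1.2 p.2

variable (X) in
/-- An étale groupoid, not necessarily Hausdorff: a topological groupoid with locally compact
Hausdorff unit space whose source and range maps are local homeomorphisms. -/
class IsEtale : Prop extends IsTopologicalGroupoid X, T2Space X, LocallyCompactSpace X where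
  isLocalHomeomorph_src : IsLocalHomeomorph (Arr.src : Arr X → X)
  isLocalHomeomorph_tgt : IsLocalHomeomorph (Arr.tgt : Arr X → X)

/-- A bisection: source and range are homeomorphisms from `A` onto their images. -/
structure IsBisection (A : Set (Arr X)) : Prop where
  src : IsEmbedding fun g : A => g.1.src
  tgt : IsEmbedding fun g : A => g.1.tgt

/-- `f` vanishes outside an open bisection `U`, and `f|_U` is continuous with compact support. -/
def IsBisectionFun (f : Arr X → ℂ) : Prop :=
  ∃ U : Set (Arr X), IsOpen U ∧ IsBisection U ∧ ContinuousOn f U ∧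
    ∃ K ⊆ U, IsCompact K ∧ ∀ g ∉ K, f g = 0

variable (X) in
/-- The space `C_c(𝒢)`, spanned by the functions that are continuous with compact support on an
open bisection and vanish outside of it. -/
def Cc : Submodule ℂ (Arr X → ℂ) := Submodule.span ℂ {f | IsBisectionFun f}

section Bisection

variable [IsEtale X]

theorem continuous_src : Continuous (Arr.src : Arr X → X) :=
  (IsEtale.isLocalHomeomorph_src (X := X)).continuous

theorem continuous_tgt : Continuous (Arr.tgt : Arr X → X) :=
  (IsEtale.isLocalHomeomorph_tgt (X := X)).continuous

theorem continuous_inv : Continuous (Arr.inv : Arr X → Arr X) :=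
  IsTopologicalGroupoid.continuous_inv

theorem IsBisection.injOn_src {A : Set (Arr X)} (h : IsBisection A) : Set.InjOn Arr.src A :=
  Set.injOn_iff_injective.2 h.src.injective

theorem IsBisection.injOn_tgt {A : Set (Arr X)} (h : IsBisection A) : Set.InjOn Arr.tgt A :=
  Set.injOn_iff_injective.2 h.tgt.injective

theorem isBisection_of_isOpen {U : Set (Arr X)} (hU : IsOpen U) (hs : Set.InjOn Arr.src U)
    (ht : Set.InjOn Arr.tgt U) : IsBisection U where
  src := (IsOpenEmbedding.of_continuous_injective_isOpenMap
    (continuous_src.comp continuous_subtype_val) (Set.injOn_iff_injective.1 hs)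
    ((IsEtale.isLocalHomeomorph_src (X := X)).isOpenMap.comp hU.isOpenMap_subtype_val)).isEmbedding
  tgt := (IsOpenEmbedding.of_continuous_injective_isOpenMap
    (continuous_tgt.comp continuous_subtype_val) (Set.injOn_iff_injective.1 ht)
    ((IsEtale.isLocalHomeomorph_tgt (X := X)).isOpenMap.comp hU.isOpenMap_subtype_val)).isEmbedding

/-- A continuous local inverse of the source map on an open bisection. -/
theorem exists_section {U : Set (Arr X)} (hU : IsOpen U) (hs : Set.InjOn Arr.src U) :
    ∃ σ : X → Arr X, ContinuousOn σ (Arr.src '' U) ∧ ∀ g ∈ U, σ g.src = g := by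
  classical
  let σ : X → Arr X := fun x => if h : ∃ g ∈ U, g.src = x then h.choose else Arr.unit x
  have hσ : ∀ g ∈ U, σ g.src = g := by
    intro g hg
    have h : ∃ g' ∈ U, g'.src = g.src := ⟨g, hg, rfl⟩
    simp only [σ, dif_pos h]
    exact hs h.choose_spec.1 hg h.choose_spec.2
  refine ⟨σ, ?_, hσ⟩
  rintro _ ⟨g, hg, rfl⟩
  refine ContinuousAt.continuousWithinAt ?_
  rw [ContinuousAt, hσ g hg]
  intro W hW
  have h1 : W ∩ U ∈ 𝓝 g := Filter.inter_mem hW (hU.mem_nhds hg)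
  have h2 := (IsEtale.isLocalHomeomorph_src (X := X)).isOpenMap.image_mem_nhds h1
  refine Filter.mem_map.2 (Filter.mem_of_superset h2 ?_)
  rintro _ ⟨g', hg', rfl⟩
  change σ g'.src ∈ W
  rw [hσ g' hg'.2]
  exact hg'.1

/-- The product of two sets of arrows. -/
def mulSet (U V : Set (Arr X)) : Set (Arr X) :=
  {g | ∃ a ∈ U, ∃ b ∈ V, ∃ w : a.src = b.tgt, g = Arr.mul a b w}

theorem isCompact_mulSet {K L : Set (Arr X)} (hK : IsCompact K) (hL : IsCompact L) :
    IsCompact (mulSet K L) := by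
  have hc : IsClosed {p : Arr X × Arr X | p.1.src = p.2.tgt} :=
    isClosed_eq (continuous_src.comp continuous_fst) (continuous_tgt.comp continuous_snd)
  have h1 : IsCompact ((Subtype.val : {p : Arr X × Arr X // p.1.src = p.2.tgt} → _) ⁻¹' (K ×ˢ L)) :=
    hc.isClosedEmbedding_subtypeVal.isCompact_preimage (hK.prod hL)
  have h2 := h1.image (IsTopologicalGroupoid.continuous_mul (X := X))
  convert h2 using 1
  ext g
  constructor
  · rintro ⟨a, ha, b, hb, w, rfl⟩
    exact ⟨⟨(a, b), w⟩, ⟨ha, hb⟩, rfl⟩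
  · rintro ⟨⟨⟨a, b⟩, w⟩, ⟨ha, hb⟩, rfl⟩
    exact ⟨a, ha, b, hb, w, rfl⟩

theorem isOpen_mulSet {U V : Set (Arr X)} (hU : IsOpen U) (hUs : Set.InjOn Arr.src U)
    (hV : IsOpen V) (hVs : Set.InjOn Arr.src V) : IsOpen (mulSet U V) := by
  obtain ⟨σ, hσc, hσ⟩ := exists_section hU hUs
  obtain ⟨τ, hτc, hτ⟩ := exists_section hV hVs
  have hsV : IsOpen (Arr.src '' V) := (IsEtale.isLocalHomeomorph_src (X := X)).isOpenMap _ hV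
  have hsU : IsOpen (Arr.src '' U) := (IsEtale.isLocalHomeomorph_src (X := X)).isOpenMap _ hU
  have htc : ContinuousOn (fun x => (τ x).tgt) (Arr.src '' V) := continuous_tgt.comp_continuousOn hτc
  let O : Set X := Arr.src '' V ∩ (fun x => (τ x).tgt) ⁻¹' (Arr.src '' U)
  have hO : IsOpen O := htc.isOpen_inter_preimage hsV hsU
  have hw : ∀ x ∈ O, (σ (τ x).tgt).src = (τ x).tgt := by
    rintro x ⟨-, a, ha, hax⟩
    change a.src = (τ x).tgt at hax
    rw [← hax, hσ a ha]
  have hτs : ∀ x ∈ O, (τ x).src = x := by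
    rintro _ ⟨⟨b, hb, rfl⟩, -⟩
    rw [hτ b hb]
  let φ : O → Arr X := fun x => Arr.mul (σ (τ x.1).tgt) (τ x.1) (hw x.1 x.2)
  have hφ : Continuous φ := by
    have h1 : Continuous fun x : O => τ x.1 :=
      continuousOn_iff_continuous_domRestrict.1 (hτc.mono Set.inter_subset_left)
    have h2 : Continuous fun x : O => σ (τ x.1).tgt :=
      hσc.comp_continuous (continuous_tgt.comp h1) fun x => x.2.2
    exact (IsTopologicalGroupoid.continuous_mul (X := X)).comp
      ((h2.prodMk h1).subtype_mk fun x => hw x.1 x.2)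
  have hφs : Arr.src ∘ φ = Subtype.val := by
    ext x
    exact hτs x.1 x.2
  have hloc : IsLocalHomeomorph φ := by
    refine IsLocalHomeomorph.of_comp (g := Arr.src) ?_ IsEtale.isLocalHomeomorph_src hφ
    rw [hφs]
    exact hO.isOpenEmbedding_subtypeVal.isLocalHomeomorph
  convert hloc.isOpenMap.isOpen_range using 1
  ext g
  constructor
  · rintro ⟨a, ha, b, hb, w, rfl⟩
    have hb' := hτ b hb
    have ha' : σ (τ b.src).tgt = a := by rw [hb', ← w, hσ a ha]
    refine ⟨⟨b.src, ⟨b, hb, rfl⟩, ⟨a, ha, ?_⟩⟩, ?_⟩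
    · change a.src = (τ b.src).tgt
      rw [hb', w]
    · simp only [φ]
      congr 1
  · rintro ⟨⟨x, ⟨b, hb, rfl⟩, ⟨a, ha, hax⟩⟩, rfl⟩
    change a.src = (τ b.src).tgt at hax
    have ha' : σ (τ b.src).tgt = a := by rw [← hax, hσ a ha]
    refine ⟨σ (τ b.src).tgt, ?_, τ b.src, ?_, ?_, rfl⟩
    · rwa [ha']
    · rwa [hτ b hb]
    · rw [ha', hax]

theorem injOn_src_mulSet {U V : Set (Arr X)} (hU : Set.InjOn Arr.src U)
    (hV : Set.InjOn Arr.src V) : Set.InjOn Arr.src (mulSet U V) := by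
  rintro _ ⟨a, ha, b, hb, w, rfl⟩ _ ⟨a', ha', b', hb', w', rfl⟩ h
  obtain rfl : b = b' := hV hb hb' h
  obtain rfl : a = a' := hU ha ha' (w.trans w'.symm)
  rfl

theorem injOn_tgt_mulSet {U V : Set (Arr X)} (hU : Set.InjOn Arr.tgt U)
    (hV : Set.InjOn Arr.tgt V) : Set.InjOn Arr.tgt (mulSet U V) := by
  rintro _ ⟨a, ha, b, hb, w, rfl⟩ _ ⟨a', ha', b', hb', w', rfl⟩ h
  obtain rfl : a = a' := hU ha ha' h
  obtain rfl : b = b' := hV hb hb' (w.symm.trans w')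
  rfl

theorem mul_eq_of_fiber {x : X} (g h : Fiber x) : Arr.mul (g.div h) h.toArr rfl = g.toArr := by
  simp [Arr.mul, Fiber.div, Fiber.toArr]

theorem convolve_mul {f₁ f₂ : Arr X → ℂ} {V : Set (Arr X)} (hV : Set.InjOn Arr.src V)
    (h₂ : ∀ g ∉ V, f₂ g = 0) (a b : Arr X) (w : a.src = b.tgt) (hb : b ∈ V) :
    convolve f₁ f₂ (Arr.mul a b w) = f₁ a * f₂ b := by
  obtain ⟨y, z, a⟩ := a
  obtain ⟨x, y', b⟩ := b
  obtain rfl : y = y' := w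
  rw [Arr.mul_mk]
  change ∑' h : Fiber x, f₁ (Fiber.div ⟨z, b ≫ a⟩ h) * f₂ h.toArr = _
  rw [tsum_eq_single (⟨y, b⟩ : Fiber x)]
  · simp [Fiber.div, Fiber.toArr]
  · intro h hh
    rw [h₂, mul_zero]
    intro hV'
    apply hh
    have := hV hV' hb rfl
    obtain ⟨y', h⟩ := h
    simp only [Fiber.toArr, Arr.mk.injEq, true_and] at this
    obtain ⟨rfl, this⟩ := this
    rw [eq_of_heq this]

theorem convolve_eq_zero {f₁ f₂ : Arr X → ℂ} {K L : Set (Arr X)}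
    (h₁ : ∀ g ∉ K, f₁ g = 0) (h₂ : ∀ g ∉ L, f₂ g = 0) (g : Arr X) (hg : g ∉ mulSet K L) :
    convolve f₁ f₂ g = 0 := by
  unfold convolve
  refine (tsum_congr fun h => ?_).trans tsum_zero
  by_contra hne
  obtain ⟨h1, h2⟩ := mul_ne_zero_iff.1 hne
  apply hg
  refine ⟨_, by_contra fun h => h1 (h₁ _ h), _, by_contra fun h => h2 (h₂ _ h), rfl, ?_⟩
  rw [mul_eq_of_fiber]
  rfl

theorem IsBisectionFun.convolve {f₁ f₂ : Arr X → ℂ} (h₁ : IsBisectionFun f₁)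
    (h₂ : IsBisectionFun f₂) : IsBisectionFun (convolve f₁ f₂) := by
  obtain ⟨U, hU, hUb, hUc, K, hKU, hK, hf₁⟩ := h₁
  obtain ⟨V, hV, hVb, hVc, L, hLV, hL, hf₂⟩ := h₂
  have hopen := isOpen_mulSet hU hUb.injOn_src hV hVb.injOn_src
  refine ⟨mulSet U V, hopen, isBisection_of_isOpen hopen
    (injOn_src_mulSet hUb.injOn_src hVb.injOn_src) (injOn_tgt_mulSet hUb.injOn_tgt hVb.injOn_tgt),
    ?_, mulSet K L, ?_, isCompact_mulSet hK hL, convolve_eq_zero hf₁ hf₂⟩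
  · obtain ⟨σ, hσc, hσ⟩ := exists_section hU hUb.injOn_src
    obtain ⟨τ, hτc, hτ⟩ := exists_section hV hVb.injOn_src
    have e : ∀ g ∈ mulSet U V, τ g.src ∈ V ∧ (τ g.src).tgt ∈ Arr.src '' U ∧
        σ (τ g.src).tgt ∈ U ∧
        EtaleGroupoid.convolve f₁ f₂ g = f₁ (σ (τ g.src).tgt) * f₂ (τ g.src) := by
      rintro _ ⟨a, ha, b, hb, w, rfl⟩
      have hb' : τ (Arr.mul a b w).src = b := hτ b hb
      have ha' : σ b.tgt = a := by rw [← w, hσ a ha]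
      rw [hb', ha']
      exact ⟨hb, ⟨a, ha, w⟩, ha,
        convolve_mul hVb.injOn_src (fun g hg => hf₂ g fun h => hg (hLV h)) a b w hb⟩
    have c1 : ContinuousOn (fun g : Arr X => τ g.src) (mulSet U V) :=
      hτc.comp continuous_src.continuousOn fun g hg => by
        obtain ⟨a, ha, b, hb, w, rfl⟩ := hg
        exact ⟨b, hb, rfl⟩
    have c2 : ContinuousOn (fun g : Arr X => σ (τ g.src).tgt) (mulSet U V) :=
      hσc.comp (continuous_tgt.comp_continuousOn c1) fun g hg => (e g hg).2.1
    refine ContinuousOn.congr ?_ fun g hg => (e g hg).2.2.2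
    exact (hUc.comp c2 fun g hg => (e g hg).2.2.1).mul (hVc.comp c1 fun g hg => (e g hg).1)
  · rintro _ ⟨a, ha, b, hb, w, rfl⟩
    exact ⟨a, hKU ha, b, hLV hb, w, rfl⟩

theorem IsBisectionFun.involution {f : Arr X → ℂ} (h : IsBisectionFun f) :
    IsBisectionFun (involution f) := by
  obtain ⟨U, hU, hUb, hUc, K, hKU, hK, hf⟩ := h
  have hopen : IsOpen (Arr.inv ⁻¹' U) := hU.preimage continuous_inv
  refine ⟨Arr.inv ⁻¹' U, hopen, isBisection_of_isOpen hopen ?_ ?_, ?_, Arr.inv ⁻¹' K,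
    Set.preimage_mono hKU, ?_, fun g hg => ?_⟩
  · intro g hg g' hg' h
    rw [← g.inv_inv, ← g'.inv_inv, hUb.injOn_tgt hg hg' h]
  · intro g hg g' hg' h
    rw [← g.inv_inv, ← g'.inv_inv, hUb.injOn_src hg hg' h]
  · exact continuous_star.comp_continuousOn (hUc.comp continuous_inv.continuousOn fun g hg => hg)
  · have : Arr.inv ⁻¹' K = Arr.inv '' K := by
      ext g
      exact ⟨fun h => ⟨g.inv, h, g.inv_inv⟩, by rintro ⟨g', h, rfl⟩; simpa [Arr.inv_inv] using h⟩
    rw [this]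
    exact hK.image continuous_inv
  · simp [EtaleGroupoid.involution, hf _ hg]

end Bisection

section Reduced

variable [IsEtale X]

/-- The matrix `(g, h) ↦ f (g h⁻¹)` of left convolution by `f` on `ℓ²(𝒢_x)`. -/
def convKernel (f : Arr X → ℂ) (x : X) (g h : Fiber x) : ℂ := f (g.div h)

theorem tsum_le_of_subsingleton {ι : Type*} {k : ι → ℂ} {M : ℝ≥0} (hk : ∀ i, ‖k i‖ₑ ≤ M)
    (h : ∀ i j, k i ≠ 0 → k j ≠ 0 → i = j) : ∑' i, ‖k i‖ₑ ≤ M := by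
  by_cases h0 : ∃ i, k i ≠ 0
  · obtain ⟨i, hi⟩ := h0
    rw [tsum_eq_single i fun j hj => ?_]
    · exact hk i
    · rw [enorm_eq_zero]
      by_contra hne
      exact hj (h j i hne hi)
  · push Not at h0
    simp [h0]

theorem IsBisectionFun.exists_schurBound {f : Arr X → ℂ} (hf : IsBisectionFun f) :
    ∃ M, ∀ x, SchurBound (convKernel f x) M := by
  obtain ⟨U, hU, hUb, hUc, K, hKU, hK, hf⟩ := hf
  obtain ⟨C, hC⟩ := hK.exists_bound_of_continuousOn (hUc.mono hKU)
  have hM : ∀ g, ‖f g‖ₑ ≤ (C.toNNReal : ℝ≥0∞) := by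
    intro g
    by_cases hg : g ∈ K
    · rw [enorm_eq_nnnorm]
      norm_cast
      exact NNReal.le_toNNReal_of_coe_le (hC g hg)
    · simp [hf g hg]
  have hmem : ∀ g, f g ≠ 0 → g ∈ U := fun g hg => hKU (by_contra fun h => hg (hf g h))
  refine ⟨C.toNNReal, fun x => ⟨fun g => ?_, fun h => ?_⟩⟩
  · refine tsum_le_of_subsingleton (fun h => hM _) fun h h' h1 h2 => ?_
    exact Fiber.div_right_injective (hUb.injOn_tgt (hmem _ h1) (hmem _ h2) rfl)
  · refine tsum_le_of_subsingleton (fun h => hM _) fun g g' h1 h2 => ?_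
    exact Fiber.div_left_injective (hUb.injOn_src (hmem _ h1) (hmem _ h2) rfl)

theorem exists_schurBound (f : Cc X) : ∃ M, ∀ x, SchurBound (convKernel f.1 x) M := by
  obtain ⟨f, hf⟩ := f
  induction hf using Submodule.span_induction with
  | mem f hf => exact IsBisectionFun.exists_schurBound hf
  | zero =>
    refine ⟨0, fun x => ⟨fun g => ?_, fun g => ?_⟩⟩ <;> simp [convKernel]
  | add f₁ f₂ _ _ h₁ h₂ =>
    obtain ⟨M₁, h₁⟩ := h₁
    obtain ⟨M₂, h₂⟩ := h₂
    refine ⟨M₁ + M₂, fun x => ⟨fun g => ?_, fun g => ?_⟩⟩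
    · refine le_trans ?_ (add_le_add ((h₁ x).row g) ((h₂ x).row g))
      rw [← ENNReal.tsum_add]
      exact ENNReal.tsum_le_tsum fun h => enorm_add_le _ _
    · refine le_trans ?_ (add_le_add ((h₁ x).col g) ((h₂ x).col g))
      rw [← ENNReal.tsum_add]
      exact ENNReal.tsum_le_tsum fun h => enorm_add_le _ _
  | smul a f _ h =>
    obtain ⟨M, h⟩ := h
    refine ⟨‖a‖₊ * M, fun x => ⟨fun g => ?_, fun g => ?_⟩⟩
    · push_cast
      refine le_trans ?_ (mul_le_mul_right ((h x).row g) _)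
      rw [← ENNReal.tsum_mul_left]
      exact ENNReal.tsum_le_tsum fun h => (enorm_mul _ _).le
    · push_cast
      refine le_trans ?_ (mul_le_mul_right ((h x).col g) _)
      rw [← ENNReal.tsum_mul_left]
      exact ENNReal.tsum_le_tsum fun h => (enorm_mul _ _).le

theorem schurBound_convKernel (f : Cc X) (x : X) : ∃ M, SchurBound (convKernel f.1 x) M :=
  let ⟨M, h⟩ := exists_schurBound f
  ⟨M, h x⟩

/-- The regular representation `λ_x` of `C_c(𝒢)` on `ℓ²(𝒢_x)` by left convolution:
`(λ_x(f) ξ)(g) = ∑_{h ∈ 𝒢_x} f(g h⁻¹) ξ(h)`. -/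
def regRep (x : X) : Cc X →ₗ[ℂ] (Ell2 (Fiber x) →L[ℂ] Ell2 (Fiber x)) where
  toFun f := kernelOp (convKernel f.1 x) (schurBound_convKernel f x)
  map_add' f₁ f₂ := by
    refine op_ext fun i j => ?_
    change _ = kernelOp _ _ (delta j) i + kernelOp _ _ (delta j) i
    simp only [kernelOp_delta]
    rfl
  map_smul' a f := by
    refine op_ext fun i j => ?_
    change _ = a * kernelOp _ _ (delta j) i
    simp only [kernelOp_delta]
    rfl

theorem regRep_apply (x : X) (f : Cc X) (ξ : Ell2 (Fiber x)) (g : Fiber x) :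
    regRep x f ξ g = ∑' h : Fiber x, f.1 (g.div h) * ξ h := rfl

theorem regRep_delta (x : X) (f : Cc X) (g h : Fiber x) :
    regRep x f (delta h) g = f.1 (g.div h) := kernelOp_delta _ (schurBound_convKernel f x) _ _

variable (X) in
/-- The C⋆-algebra of bounded families of operators on the Hilbert spaces `ℓ²(𝒢_x)`, with the
norm `sup_x ‖a_x‖`, i.e. the block diagonal operators on `⨁_x ℓ²(𝒢_x)`. -/
def RegOps : Type _ := lp (fun x : X => Ell2 (Fiber x) →L[ℂ] Ell2 (Fiber x)) ∞

instance : NonUnitalCStarAlgebra (RegOps X) :=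
  inferInstanceAs (NonUnitalCStarAlgebra (lp (fun x : X => Ell2 (Fiber x) →L[ℂ] Ell2 (Fiber x)) ∞))

/-- The family `(a_x)_x` of operators with `‖a_x‖ ≤ C` for all `x`. -/
def RegOps.mk (a : ∀ x : X, Ell2 (Fiber x) →L[ℂ] Ell2 (Fiber x)) (h : ∃ C, ∀ x, ‖a x‖ ≤ C) :
    RegOps X :=
  ⟨a, memℓp_infty (by
    obtain ⟨C, hC⟩ := h
    refine ⟨C, ?_⟩
    rintro _ ⟨x, rfl⟩
    exact hC x)⟩

/-- The component `a_x` of a family of operators. -/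
def RegOps.component (x : X) : RegOps X →⋆ₙₐ[ℂ] (Ell2 (Fiber x) →L[ℂ] Ell2 (Fiber x)) where
  toFun a := a.1 x
  map_smul' _ _ := rfl
  map_zero' := rfl
  map_add' _ _ := rfl
  map_mul' _ _ := rfl
  map_star' _ := rfl

theorem RegOps.component_mk (a : ∀ x : X, Ell2 (Fiber x) →L[ℂ] Ell2 (Fiber x))
    (h : ∃ C, ∀ x, ‖a x‖ ≤ C) (x : X) : RegOps.component x (RegOps.mk a h) = a x := rfl

theorem RegOps.ext {a b : RegOps X}
    (h : ∀ x, RegOps.component x a = RegOps.component x b) : a = b :=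
  Subtype.ext (funext h)

theorem RegOps.norm_component_le (x : X) (a : RegOps X) : ‖RegOps.component x a‖ ≤ ‖a‖ :=
  lp.norm_apply_le_norm (by simp) (a : lp (fun x : X => Ell2 (Fiber x) →L[ℂ] Ell2 (Fiber x)) ∞) x

theorem RegOps.norm_le {a : RegOps X} {C : ℝ} (hC : 0 ≤ C)
    (h : ∀ x, ‖RegOps.component x a‖ ≤ C) : ‖a‖ ≤ C :=
  lp.norm_le_of_forall_le (f := (a : lp (fun x : X => Ell2 (Fiber x) →L[ℂ] Ell2 (Fiber x)) ∞)) hC h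

/-- The direct sum `λ` of the representations `λ_x`. -/
def regRepSum : Cc X →ₗ[ℂ] RegOps X where
  toFun f := RegOps.mk (fun x => regRep x f) (by
    obtain ⟨M, hM⟩ := exists_schurBound f
    exact ⟨M, fun x => kernelOp_norm_le (hM x) (schurBound_convKernel f x)⟩)
  map_add' f₁ f₂ := RegOps.ext fun x => map_add (regRep x) f₁ f₂
  map_smul' a f := RegOps.ext fun x => map_smul (regRep x) a f

theorem component_regRepSum (f : Cc X) (x : X) :
    RegOps.component x (regRepSum f) = regRep x f := rfl

theorem convKernel_convolve (f₁ f₂ : Arr X → ℂ) (x : X) (g h : Fiber x) :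
    convKernel (convolve f₁ f₂) x g h = ∑' l, convKernel f₁ x g l * convKernel f₂ x l h := by
  unfold convKernel
  rw [← (Fiber.divEquiv h).symm.tsum_eq]
  change ∑' m : Fiber h.1, f₁ (Fiber.div (⟨g.1, Groupoid.inv h.2 ≫ g.2⟩ : Fiber h.1) m) * f₂ m.toArr
    = _
  refine tsum_congr fun m => ?_
  simp [Fiber.divEquiv, Fiber.div, Fiber.toArr]

theorem regRepSum_mul_of_convolve_mem (f₁ f₂ : Cc X) (h : convolve f₁.1 f₂.1 ∈ Cc X) :
    regRepSum f₁ * regRepSum f₂ = regRepSum ⟨convolve f₁.1 f₂.1, h⟩ := by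
  refine RegOps.ext fun x => ?_
  rw [map_mul]
  exact kernelOp_mul (schurBound_convKernel _ x) (schurBound_convKernel _ x)
    (schurBound_convKernel _ x) fun i j => convKernel_convolve _ _ _ _ _

theorem range_mul_mem {V A : Type*} [AddCommGroup V] [Module ℂ V] [NonUnitalRing A] [Module ℂ A]
    [IsScalarTower ℂ A A] [SMulCommClass ℂ A A] {s : Set V} (φ : Submodule.span ℂ s →ₗ[ℂ] A)
    (h : ∀ p q, ∀ hp : p ∈ s, ∀ hq : q ∈ s, φ ⟨p, Submodule.subset_span hp⟩ *
      φ ⟨q, Submodule.subset_span hq⟩ ∈ LinearMap.range φ) (p q : Submodule.span ℂ s) :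
    φ p * φ q ∈ LinearMap.range φ := by
  obtain ⟨p, hp⟩ := p
  obtain ⟨q, hq⟩ := q
  induction hp using Submodule.span_induction with
  | zero =>
    have : φ ⟨0, Submodule.zero_mem _⟩ = 0 := map_zero φ
    rw [this, zero_mul]
    exact zero_mem _
  | add p q hp hq h₁ h₂ =>
    have : φ ⟨p + q, Submodule.add_mem _ hp hq⟩ = φ ⟨p, hp⟩ + φ ⟨q, hq⟩ :=
      map_add φ ⟨p, hp⟩ ⟨q, hq⟩
    rw [this, add_mul]
    exact add_mem h₁ h₂
  | smul a p hp h =>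
    have : φ ⟨a • p, Submodule.smul_mem _ a hp⟩ = a • φ ⟨p, hp⟩ := map_smul φ a ⟨p, hp⟩
    rw [this, smul_mul_assoc]
    exact Submodule.smul_mem _ a h
  | mem p hp =>
    induction hq using Submodule.span_induction with
    | zero =>
      have : φ ⟨0, Submodule.zero_mem _⟩ = 0 := map_zero φ
      rw [this, mul_zero]
      exact zero_mem _
    | add q r hq hr h₁ h₂ =>
      have : φ ⟨q + r, Submodule.add_mem _ hq hr⟩ = φ ⟨q, hq⟩ + φ ⟨r, hr⟩ :=
        map_add φ ⟨q, hq⟩ ⟨r, hr⟩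
      rw [this, mul_add]
      exact add_mem h₁ h₂
    | smul a q hq h =>
      have : φ ⟨a • q, Submodule.smul_mem _ a hq⟩ = a • φ ⟨q, hq⟩ := map_smul φ a ⟨q, hq⟩
      rw [this, mul_smul_comm]
      exact Submodule.smul_mem _ a h
    | mem q hq => exact h p q hp hq

theorem regRepSum_mul_mem (f₁ f₂ : Cc X) : ∃ f, regRepSum f₁ * regRepSum f₂ = regRepSum f := by
  have key : ∀ p q : Arr X → ℂ, ∀ hp : p ∈ {f | IsBisectionFun f}, ∀ hq : q ∈ {f | IsBisectionFun f},
      regRepSum (⟨p, Submodule.subset_span hp⟩ : Cc X) *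
        regRepSum (⟨q, Submodule.subset_span hq⟩ : Cc X) ∈ LinearMap.range (regRepSum (X := X)) := by
    intro p q hp hq
    have h : convolve p q ∈ Cc X := Submodule.subset_span (IsBisectionFun.convolve hp hq)
    rw [regRepSum_mul_of_convolve_mem ⟨p, Submodule.subset_span hp⟩
      ⟨q, Submodule.subset_span hq⟩ h]
    exact LinearMap.mem_range_self _ _
  obtain ⟨f, hf⟩ := range_mul_mem (regRepSum (X := X)) key f₁ f₂
  exact ⟨f, hf.symm⟩

/-- `C_c(𝒢)` is closed under convolution. -/
theorem convolve_mem (f₁ f₂ : Cc X) : convolve f₁.1 f₂.1 ∈ Cc X := by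
  obtain ⟨f, hf⟩ := regRepSum_mul_mem f₁ f₂
  suffices h : convolve f₁.1 f₂.1 = f.1 from h ▸ f.2
  funext g
  have h1 := congrArg (fun a : RegOps X => RegOps.component g.src a (delta (Fiber.unit g.src)) g.toFiber) hf
  have h2 : regRep g.src f₁ (regRep g.src f₂ (delta (Fiber.unit g.src))) g.toFiber
      = regRep g.src f (delta (Fiber.unit g.src)) g.toFiber := h1
  rw [regRep_delta, g.toFiber_div_unit, regRep_apply] at h2
  rw [← h2]
  refine tsum_congr fun h => ?_
  rw [regRep_delta]
  simp [Fiber.div, Fiber.unit, Fiber.toArr]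

/-- `C_c(𝒢)` is closed under the involution. -/
theorem involution_mem (f : Cc X) : involution f.1 ∈ Cc X := by
  obtain ⟨f, hf⟩ := f
  change involution f ∈ Cc X
  induction hf using Submodule.span_induction with
  | mem f hf => exact Submodule.subset_span (IsBisectionFun.involution hf)
  | zero =>
    convert zero_mem (Cc X) using 1
    funext g
    simp [involution]
  | add f₁ f₂ _ _ h₁ h₂ =>
    convert add_mem h₁ h₂ using 1
    funext g
    simp [involution]
  | smul a f _ h =>
    convert Submodule.smul_mem (Cc X) (star a) h using 1
    funext g
    simp [involution]

/-- The convolution product on `C_c(𝒢)`. -/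
instance : Mul (Cc X) := ⟨fun f₁ f₂ => ⟨convolve f₁.1 f₂.1, convolve_mem f₁ f₂⟩⟩

/-- The involution on `C_c(𝒢)`. -/
instance : Star (Cc X) := ⟨fun f => ⟨involution f.1, involution_mem f⟩⟩

theorem regRepSum_mul (f₁ f₂ : Cc X) : regRepSum (f₁ * f₂) = regRepSum f₁ * regRepSum f₂ :=
  (regRepSum_mul_of_convolve_mem _ _ _).symm

theorem regRepSum_star (f : Cc X) : regRepSum (star f) = star (regRepSum f) := by
  refine RegOps.ext fun x => ?_
  rw [map_star (RegOps.component x)]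
  refine (kernelOp_star (schurBound_convKernel _ x) (schurBound_convKernel _ x) fun g h => ?_).symm
  change star (f.1 (g.div h).inv) = star (f.1 (h.div g))
  rw [Fiber.inv_div]

variable (X) in
/-- The ⋆-algebra `λ(C_c(𝒢))`. -/
def regRepRange : NonUnitalStarSubalgebra ℂ (RegOps X) where
  carrier := Set.range regRepSum
  add_mem' := by
    rintro _ _ ⟨f₁, rfl⟩ ⟨f₂, rfl⟩
    exact ⟨f₁ + f₂, map_add _ _ _⟩
  zero_mem' := ⟨0, map_zero _⟩
  mul_mem' := by
    rintro _ _ ⟨f₁, rfl⟩ ⟨f₂, rfl⟩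
    exact ⟨f₁ * f₂, regRepSum_mul _ _⟩
  smul_mem' := by
    rintro a _ ⟨f, rfl⟩
    exact ⟨a • f, map_smul _ _ _⟩
  star_mem' := by
    rintro _ ⟨f, rfl⟩
    exact ⟨star f, regRepSum_star _⟩

variable (X) in
/-- The reduced C⋆-algebra `C*_r(𝒢)`: the completion of `C_c(𝒢)` for the norm
`‖f‖ = sup_x ‖λ_x(f)‖`, realized as the closure of `λ(C_c(𝒢))`. -/
abbrev ReducedCStar : Type _ := (regRepRange X).topologicalClosure

instance : IsClosed ((regRepRange X).topologicalClosure : Set (RegOps X)) :=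
  NonUnitalStarSubalgebra.isClosed_topologicalClosure _

/-- The canonical map `C_c(𝒢) → C*_r(𝒢)`. -/
def toReduced : Cc X →ₗ[ℂ] ReducedCStar X where
  toFun f := ⟨regRepSum f, subset_closure ⟨f, rfl⟩⟩
  map_add' f₁ f₂ := Subtype.ext (map_add regRepSum f₁ f₂)
  map_smul' a f := Subtype.ext (map_smul regRepSum a f)

theorem denseRange_toReduced : DenseRange (toReduced : Cc X → ReducedCStar X) := by
  intro a
  rw [closure_subtype]
  refine closure_mono ?_ a.2
  rintro _ ⟨f, rfl⟩
  exact ⟨toReduced f, ⟨f, rfl⟩, rfl⟩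

/-- An element `a` of `C*_r(𝒢)` as a function on `𝒢`: `a(γ) = ⟨λ_x(a) δ_x, δ_γ⟩` with `x = s(γ)`
(the inner product of Mathlib is linear in its second argument). -/
def toFunction (a : ReducedCStar X) (γ : Arr X) : ℂ :=
  inner ℂ (delta γ.toFiber) (RegOps.component γ.src a.1 (delta (Fiber.unit γ.src)))

/-- On `C_c(𝒢)`, one recovers the original function. -/
theorem toFunction_toReduced (f : Cc X) : toFunction (toReduced f) = f.1 := by
  funext γ
  unfold toFunction
  rw [inner_delta]
  refine (regRep_delta _ f _ _).trans ?_
  rw [γ.toFiber_div_unit]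

end Reduced

section Graded

variable (X) in
/-- A continuous `ℤ`-valued cocycle on the groupoid (a `ℤ`-grading). -/
structure Cocycle where
  toFun : Arr X → ℤ
  continuous_toFun : Continuous toFun
  map_mul' : ∀ (g h : Arr X) (w : g.src = h.tgt), toFun (g.mul h w) = toFun g + toFun h

namespace Cocycle

instance : CoeFun (Cocycle X) fun _ => Arr X → ℤ := ⟨toFun⟩

theorem map_comp (c : Cocycle X) {x y z : X} (h : x ⟶ y) (g : y ⟶ z) :
    c ⟨x, z, h ≫ g⟩ = c ⟨y, z, g⟩ + c ⟨x, y, h⟩ := by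
  rw [← c.map_mul' ⟨y, z, g⟩ ⟨x, y, h⟩ rfl, Arr.mul_mk]

theorem map_id (c : Cocycle X) (x : X) : c ⟨x, x, 𝟙 x⟩ = 0 := by
  have := c.map_comp (𝟙 x) (𝟙 x)
  rw [Category.comp_id] at this
  omega

theorem map_inv (c : Cocycle X) {x y : X} (g : x ⟶ y) :
    c ⟨y, x, Groupoid.inv g⟩ = - c ⟨x, y, g⟩ := by
  have := c.map_comp g (Groupoid.inv g)
  rw [Groupoid.comp_inv, map_id] at this
  omega

theorem comp_eq_zero (c : Cocycle X) {x y z : X} {h : x ⟶ y} {g : y ⟶ z}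
    (hh : c ⟨x, y, h⟩ = 0) (hg : c ⟨y, z, g⟩ = 0) : c ⟨x, z, h ≫ g⟩ = 0 := by
  rw [c.map_comp, hh, hg, add_zero]

theorem inv_eq_zero (c : Cocycle X) {x y : X} {g : x ⟶ y} (hg : c ⟨x, y, g⟩ = 0) :
    c ⟨y, x, Groupoid.inv g⟩ = 0 := by
  rw [c.map_inv, hg, neg_zero]

theorem map_div (c : Cocycle X) {x : X} (g h : Fiber x) :
    c (g.div h) = c g.toArr - c h.toArr := by
  unfold Fiber.div Fiber.toArr
  rw [map_comp, map_inv]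
  ring

end Cocycle

/-- The unit space of the groupoid `𝒢₀ = c⁻¹(0)`, which is the unit space of `𝒢`. -/
def DegreeZero (_c : Cocycle X) : Type u := X

section DegreeZero

variable (c : Cocycle X)

instance : TopologicalSpace (DegreeZero c) := inferInstanceAs (TopologicalSpace X)

/-- The groupoid `𝒢₀ = c⁻¹(0)`: its arrows are the arrows of `𝒢` of degree zero. -/
instance : Groupoid.{v} (DegreeZero c) where
  Hom x y := {g : @Quiver.Hom X _ x y // c ⟨x, y, g⟩ = 0}
  id x := ⟨CategoryStruct.id (obj := X) x, c.map_id x⟩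
  comp f g := ⟨CategoryStruct.comp (obj := X) f.1 g.1, c.comp_eq_zero f.2 g.2⟩
  inv f := ⟨Groupoid.inv (obj := X) f.1, c.inv_eq_zero f.2⟩
  id_comp f := Subtype.ext (Category.id_comp (obj := X) f.1)
  comp_id f := Subtype.ext (Category.comp_id (obj := X) f.1)
  assoc f g h := Subtype.ext (Category.assoc (obj := X) f.1 g.1 h.1)
  inv_comp f := Subtype.ext (Groupoid.inv_comp (obj := X) f.1)
  comp_inv f := Subtype.ext (Groupoid.comp_inv (obj := X) f.1)

/-- The inclusion `𝒢₀ → 𝒢`. -/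
def DegreeZero.incl (g : Arr (DegreeZero c)) : Arr X := Arr.mk (X := X) g.src g.tgt g.hom.1

/-- `𝒢₀` carries the subspace topology. -/
instance : TopologicalSpace (Arr (DegreeZero c)) :=
  TopologicalSpace.induced (DegreeZero.incl c) inferInstance

theorem DegreeZero.incl_injective : Function.Injective (DegreeZero.incl c) := by
  rintro ⟨x, y, g⟩ ⟨x', y', g'⟩ h
  have hx : x = x' := congrArg Arr.src h
  have hy : y = y' := congrArg Arr.tgt h
  subst hx hy
  have hg : g.1 = g'.1 := eq_of_heq (Arr.mk.inj h).2.2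
  rw [Subtype.ext hg]

theorem DegreeZero.range_incl : Set.range (DegreeZero.incl c) = {g | c g = 0} := by
  ext g
  constructor
  · rintro ⟨g, rfl⟩
    exact g.hom.2
  · intro h
    exact ⟨Arr.mk (X := DegreeZero c) g.src g.tgt ⟨g.hom, h⟩, rfl⟩

theorem isOpen_degree (n : ℤ) : IsOpen {g | c g = n} :=
  (isOpen_discrete {n}).preimage c.continuous_toFun

theorem DegreeZero.isOpenEmbedding_incl : IsOpenEmbedding (DegreeZero.incl c) where
  eq_induced := rfl
  injective := DegreeZero.incl_injective c
  isOpen_range := by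
    rw [DegreeZero.range_incl]
    exact isOpen_degree c 0

theorem DegreeZero.incl_mul (g h : Arr (DegreeZero c)) (w : g.src = h.tgt) :
    DegreeZero.incl c (g.mul h w) = (DegreeZero.incl c g).mul (DegreeZero.incl c h) w := by
  obtain ⟨y, z, g⟩ := g
  obtain ⟨x, y', h⟩ := h
  obtain rfl : y = y' := w
  rw [Arr.mul_mk]
  exact (Arr.mul_mk (X := X) g.1 h.1).symm

variable [IsEtale X]

instance : IsEtale (DegreeZero c) where
  toT2Space := inferInstanceAs (T2Space X)
  toLocallyCompactSpace := inferInstanceAs (LocallyCompactSpace X)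
  isInducing_unit := by
    refine (DegreeZero.isOpenEmbedding_incl c).isInducing.of_comp_iff.1 ?_
    have h : DegreeZero.incl c ∘ Arr.unit = (Arr.unit : X → Arr X) := rfl
    rw [h]
    exact IsTopologicalGroupoid.isInducing_unit (X := X)
  continuous_inv := by
    rw [(DegreeZero.isOpenEmbedding_incl c).isInducing.continuous_iff]
    have h : DegreeZero.incl c ∘ Arr.inv = Arr.inv ∘ DegreeZero.incl c := rfl
    rw [h]
    exact (continuous_inv (X := X)).comp (DegreeZero.isOpenEmbedding_incl c).continuous
  continuous_mul := by
    rw [(DegreeZero.isOpenEmbedding_incl c).isInducing.continuous_iff]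
    have hc := (DegreeZero.isOpenEmbedding_incl c).continuous
    have h : Continuous fun p : {p : Arr (DegreeZero c) × Arr (DegreeZero c) // p.1.src = p.2.tgt} =>
        (⟨(DegreeZero.incl c p.1.1, DegreeZero.incl c p.1.2), p.2⟩ :
          {p : Arr X × Arr X // p.1.src = p.2.tgt}) :=
      (((hc.comp continuous_fst).prodMk (hc.comp continuous_snd)).comp
        continuous_subtype_val).subtype_mk _
    refine ((IsTopologicalGroupoid.continuous_mul (X := X)).comp h).congr fun p => ?_
    exact (DegreeZero.incl_mul c _ _ p.2).symm
  isLocalHomeomorph_src :=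
    (IsEtale.isLocalHomeomorph_src (X := X)).comp
      (DegreeZero.isOpenEmbedding_incl c).isLocalHomeomorph
  isLocalHomeomorph_tgt :=
    (IsEtale.isLocalHomeomorph_tgt (X := X)).comp
      (DegreeZero.isOpenEmbedding_incl c).isLocalHomeomorph

theorem IsBisectionFun.extend {f : Arr (DegreeZero c) → ℂ} (hf : IsBisectionFun f) :
    IsBisectionFun (Function.extend (DegreeZero.incl c) f 0) := by
  have hi := DegreeZero.isOpenEmbedding_incl c
  obtain ⟨U, hU, hUb, hUc, K, hKU, hK, hf⟩ := hf
  have hopen := hi.isOpenMap U hU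
  refine ⟨_, hopen, isBisection_of_isOpen hopen ?_ ?_, ?_, DegreeZero.incl c '' K,
    Set.image_mono hKU, hK.image hi.continuous, ?_⟩
  · rintro _ ⟨g, hg, rfl⟩ _ ⟨g', hg', rfl⟩ h
    rw [hUb.injOn_src hg hg' h]
  · rintro _ ⟨g, hg, rfl⟩ _ ⟨g', hg', rfl⟩ h
    rw [hUb.injOn_tgt hg hg' h]
  · rintro _ ⟨g, hg, rfl⟩
    refine ContinuousAt.continuousWithinAt ?_
    rw [← hi.continuousAt_iff, Function.extend_comp hi.injective]
    exact hUc.continuousAt (hU.mem_nhds hg)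
  · intro g hg
    by_cases h : ∃ g', DegreeZero.incl c g' = g
    · obtain ⟨g', rfl⟩ := h
      rw [hi.injective.extend_apply]
      exact hf g' fun h => hg ⟨g', h, rfl⟩
    · rw [Function.extend_apply' _ _ _ h]
      rfl

/-- The embedding `C_c(𝒢₀) → C_c(𝒢)`, extension by zero. -/
def extendByZero : Cc (DegreeZero c) →ₗ[ℂ] Cc X :=
  LinearMap.restrict (p := Cc (DegreeZero c)) (q := Cc X)
    (Function.ExtendByZero.linearMap ℂ (DegreeZero.incl c))
    (by
      intro f hf
      have h : Submodule.span ℂ {f | IsBisectionFun f} ≤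
          (Cc X).comap (Function.ExtendByZero.linearMap ℂ (DegreeZero.incl c)) :=
        Submodule.span_le.2 fun f hf => Submodule.subset_span (IsBisectionFun.extend c hf)
      exact h hf)

theorem extendByZero_apply (f : Cc (DegreeZero c)) :
    (extendByZero c f).1 = Function.extend (DegreeZero.incl c) f.1 0 := rfl

end DegreeZero

section Gauge

variable (c : Cocycle X)

theorem IsBisectionFun.gauge (z : Circle) {f : Arr X → ℂ} (hf : IsBisectionFun f) :
    IsBisectionFun fun g => ((z ^ c g : Circle) : ℂ) * f g := by
  obtain ⟨U, hU, hUb, hUc, K, hKU, hK, hf⟩ := hf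
  refine ⟨U, hU, hUb, ?_, K, hKU, hK, fun g hg => by simp [hf g hg]⟩
  refine ContinuousOn.mul (Continuous.continuousOn ?_) hUc
  exact (continuous_of_discreteTopology (f := fun n : ℤ => ((z ^ n : Circle) : ℂ))).comp
    c.continuous_toFun

/-- The map `T_z` on `C_c(𝒢)`, multiplying functions on `𝒢_n = c⁻¹(n)` by `z ^ n`. -/
def gaugeCc (z : Circle) : Cc X →ₗ[ℂ] Cc X where
  toFun f := ⟨fun g => ((z ^ c g : Circle) : ℂ) * f.1 g, by
    obtain ⟨f, hf⟩ := f
    induction hf using Submodule.span_induction with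
    | mem f hf => exact Submodule.subset_span (IsBisectionFun.gauge c z hf)
    | zero =>
      convert zero_mem (Cc X) using 1
      funext g
      simp
    | add f₁ f₂ _ _ h₁ h₂ =>
      convert add_mem h₁ h₂ using 1
      funext g
      simp [mul_add]
    | smul a f _ h =>
      convert Submodule.smul_mem (Cc X) a h using 1
      funext g
      simp only [Pi.smul_apply, smul_eq_mul]
      ring⟩
  map_add' f₁ f₂ := by
    ext g
    exact mul_add _ _ _
  map_smul' a f := by
    ext g
    exact mul_left_comm _ _ _

theorem gaugeCc_apply (z : Circle) (f : Cc X) (g : Arr X) :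
    (gaugeCc c z f).1 g = ((z ^ c g : Circle) : ℂ) * f.1 g := rfl

/-- The diagonal operator `δ_g ↦ z ^ c(g) δ_g` on `ℓ²(𝒢_x)`. -/
def gaugeKernel (x : X) (z : Circle) (g h : Fiber x) : ℂ :=
  letI := Classical.decEq (Fiber x)
  if g = h then ((z ^ c g.toArr : Circle) : ℂ) else 0

theorem gaugeKernel_schurBound (x : X) (z : Circle) : ∃ M, SchurBound (gaugeKernel c x z) M := by
  have h1 : ∀ g h, ‖gaugeKernel c x z g h‖ₑ ≤ ((1 : ℝ≥0) : ℝ≥0∞) := by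
    intro g h
    rw [enorm_eq_nnnorm]
    norm_cast
    rw [← NNReal.coe_le_coe, coe_nnnorm]
    unfold gaugeKernel
    split_ifs
    · exact (Circle.norm_coe _).le
    · simp
  have h2 : ∀ g h, gaugeKernel c x z g h ≠ 0 → g = h := by
    intro g h
    unfold gaugeKernel
    split_ifs with h
    · exact fun _ => h
    · simp
  refine ⟨1, fun g => ?_, fun g => ?_⟩
  · exact tsum_le_of_subsingleton (h1 g) fun i j hi hj => (h2 _ _ hi).symm.trans (h2 _ _ hj)
  · exact tsum_le_of_subsingleton (fun i => h1 i g) fun i j hi hj =>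
      (h2 _ _ hi).trans (h2 _ _ hj).symm

/-- The diagonal operator `δ_g ↦ z ^ c(g) δ_g` on `ℓ²(𝒢_x)`. -/
def gaugeOp (x : X) (z : Circle) : Ell2 (Fiber x) →L[ℂ] Ell2 (Fiber x) :=
  kernelOp (gaugeKernel c x z) (gaugeKernel_schurBound c x z)

theorem gaugeOp_apply (x : X) (z : Circle) (ξ : Ell2 (Fiber x)) (g : Fiber x) :
    gaugeOp c x z ξ g = ((z ^ c g.toArr : Circle) : ℂ) * ξ g := by
  unfold gaugeOp
  rw [kernelOp_apply, tsum_eq_single g]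
  · simp [gaugeKernel]
  · intro h hh
    simp [gaugeKernel, hh.symm]

theorem gaugeOp_delta (x : X) (z : Circle) (g : Fiber x) :
    gaugeOp c x z (delta g) = ((z ^ c g.toArr : Circle) : ℂ) • delta g := by
  ext h
  rw [gaugeOp_apply]
  change _ = _ * delta g h
  by_cases hh : h = g
  · rw [hh]
  · rw [delta_ne hh, mul_zero, mul_zero]

theorem gaugeOp_one (x : X) : gaugeOp c x 1 = 1 := by
  ext ξ g
  rw [gaugeOp_apply]
  simp

theorem gaugeOp_mul (x : X) (z w : Circle) :
    gaugeOp c x (z * w) = gaugeOp c x z * gaugeOp c x w := by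
  ext ξ g
  change _ = gaugeOp c x z (gaugeOp c x w ξ) g
  rw [gaugeOp_apply, gaugeOp_apply, gaugeOp_apply, mul_zpow, Circle.coe_mul, mul_assoc]

theorem gaugeOp_star (x : X) (z : Circle) : star (gaugeOp c x z) = gaugeOp c x z⁻¹ := by
  refine kernelOp_star _ _ fun g h => ?_
  unfold gaugeKernel
  by_cases hgh : g = h
  · subst hgh
    simp only [if_true, Circle.coe_inv_eq_conj, inv_zpow]
    rfl
  · rw [if_neg hgh, if_neg (Ne.symm hgh), star_zero]

/-- The diagonal unitaries as a representation of the circle group. -/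
def gaugeUnitary (x : X) : Circle →* unitary (Ell2 (Fiber x) →L[ℂ] Ell2 (Fiber x)) where
  toFun z := ⟨gaugeOp c x z, by
    rw [Unitary.mem_iff, gaugeOp_star, ← gaugeOp_mul, ← gaugeOp_mul, inv_mul_cancel,
      mul_inv_cancel, gaugeOp_one]
    exact ⟨rfl, rfl⟩⟩
  map_one' := Subtype.ext (gaugeOp_one c x)
  map_mul' z w := Subtype.ext (gaugeOp_mul c x z w)

/-- Conjugation by the diagonal unitaries. -/
def gaugeConj (x : X) : Circle →*
    ((Ell2 (Fiber x) →L[ℂ] Ell2 (Fiber x)) ≃⋆ₐ[ℂ] (Ell2 (Fiber x) →L[ℂ] Ell2 (Fiber x))) :=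
  (Unitary.conjStarAlgAut ℂ _).comp (gaugeUnitary c x)

theorem gaugeConj_apply (x : X) (z : Circle) (a : Ell2 (Fiber x) →L[ℂ] Ell2 (Fiber x)) :
    gaugeConj c x z a = gaugeOp c x z * a * gaugeOp c x z⁻¹ := by
  rw [← gaugeOp_star]
  rfl

theorem norm_gaugeConj (x : X) (z : Circle) (a : Ell2 (Fiber x) →L[ℂ] Ell2 (Fiber x)) :
    ‖gaugeConj c x z a‖ = ‖a‖ := StarAlgEquiv.norm_map _ _

variable [IsEtale X]

theorem gaugeConj_regRep (x : X) (z : Circle) (f : Cc X) :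
    gaugeConj c x z (regRep x f) = regRep x (gaugeCc c z f) := by
  refine op_ext fun g h => ?_
  rw [gaugeConj_apply]
  change gaugeOp c x z (regRep x f (gaugeOp c x z⁻¹ (delta h))) g = _
  rw [gaugeOp_apply, gaugeOp_delta, map_smul]
  change _ * (_ * regRep x f (delta h) g) = _
  rw [regRep_delta, regRep_delta, gaugeCc_apply, c.map_div, ← mul_assoc, ← Circle.coe_mul,
    inv_zpow, zpow_sub]

/-- Componentwise conjugation by the diagonal unitaries. -/
def gaugeReg (z : Circle) : RegOps X →⋆ₙₐ[ℂ] RegOps X where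
  toFun a := RegOps.mk (fun x => gaugeConj c x z (RegOps.component x a))
    ⟨‖a‖, fun x => by
      rw [norm_gaugeConj]
      exact RegOps.norm_component_le x a⟩
  map_smul' r a := RegOps.ext fun x => by
    simp only [map_smul, RegOps.component_mk]
    rfl
  map_zero' := RegOps.ext fun x => by
    simp only [map_zero, RegOps.component_mk]
  map_add' a b := RegOps.ext fun x => by
    simp only [map_add, RegOps.component_mk]
  map_mul' a b := RegOps.ext fun x => by
    simp only [map_mul, RegOps.component_mk]
  map_star' a := RegOps.ext fun x => by
    simp only [map_star, RegOps.component_mk]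

theorem component_gaugeReg (z : Circle) (a : RegOps X) (x : X) :
    RegOps.component x (gaugeReg c z a) = gaugeConj c x z (RegOps.component x a) := rfl

theorem gaugeReg_one (a : RegOps X) : gaugeReg c 1 a = a :=
  RegOps.ext fun x => by rw [component_gaugeReg, map_one]; rfl

theorem gaugeReg_mul (z w : Circle) (a : RegOps X) :
    gaugeReg c (z * w) a = gaugeReg c z (gaugeReg c w a) :=
  RegOps.ext fun x => by
    rw [component_gaugeReg, component_gaugeReg, component_gaugeReg, map_mul]; rfl

theorem gaugeReg_regRepSum (z : Circle) (f : Cc X) :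
    gaugeReg c z (regRepSum f) = regRepSum (gaugeCc c z f) :=
  RegOps.ext fun x => gaugeConj_regRep c x z f

theorem continuous_gaugeReg (z : Circle) : Continuous (gaugeReg (X := X) c z) :=
  AddMonoidHomClass.continuous_of_bound (gaugeReg c z) 1 fun a => by
    rw [one_mul]
    refine RegOps.norm_le (norm_nonneg _) fun x => ?_
    rw [component_gaugeReg, norm_gaugeConj]
    exact RegOps.norm_component_le x a

theorem gaugeReg_mem (z : Circle) {a : RegOps X} (ha : a ∈ (regRepRange X).topologicalClosure) :
    gaugeReg c z a ∈ (regRepRange X).topologicalClosure :=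
  map_mem_closure (continuous_gaugeReg c z) ha (by
    rintro _ ⟨f, rfl⟩
    exact ⟨gaugeCc c z f, (gaugeReg_regRepSum c z f).symm⟩)

/-- There is exactly one action of the circle group on `C*_r(𝒢)` by automorphisms which extends
the maps `T_z` on `C_c(𝒢)`. -/
theorem existsUnique_gaugeAction :
    ∃! T : Circle →* (ReducedCStar X ≃⋆ₐ[ℂ] ReducedCStar X),
      ∀ (z : Circle) (f : Cc X), T z (toReduced f) = toReduced (gaugeCc c z f) := by
  let S : Circle → (ReducedCStar X ≃⋆ₐ[ℂ] ReducedCStar X) := fun z =>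
    { toFun := fun a => ⟨gaugeReg c z a.1, gaugeReg_mem c z a.2⟩
      invFun := fun a => ⟨gaugeReg c z⁻¹ a.1, gaugeReg_mem c z⁻¹ a.2⟩
      left_inv := fun a => Subtype.ext (by
        change gaugeReg c z⁻¹ (gaugeReg c z a.1) = a.1
        rw [← gaugeReg_mul, inv_mul_cancel, gaugeReg_one])
      right_inv := fun a => Subtype.ext (by
        change gaugeReg c z (gaugeReg c z⁻¹ a.1) = a.1
        rw [← gaugeReg_mul, mul_inv_cancel, gaugeReg_one])
      map_mul' := fun a b => Subtype.ext (map_mul (gaugeReg c z) a.1 b.1)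
      map_add' := fun a b => Subtype.ext (map_add (gaugeReg c z) a.1 b.1)
      map_star' := fun a => Subtype.ext (map_star (gaugeReg c z) a.1)
      map_smul' := fun r a => Subtype.ext (map_smul (gaugeReg c z) r a.1) }
  refine ⟨{ toFun := S, map_one' := ?_, map_mul' := fun z w => ?_ }, fun z f => ?_, fun T hT => ?_⟩
  · exact StarAlgEquiv.ext fun a => Subtype.ext (gaugeReg_one c a.1)
  · exact StarAlgEquiv.ext fun a => Subtype.ext (gaugeReg_mul c z w a.1)
  · exact Subtype.ext (gaugeReg_regRepSum c z f)
  · refine MonoidHom.ext fun z => StarAlgEquiv.ext fun a => ?_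
    have h1 : Continuous (T z) := (StarAlgEquiv.isometry (T z)).continuous
    have h2 : Continuous (S z) := (StarAlgEquiv.isometry (S z)).continuous
    refine congrFun (denseRange_toReduced.equalizer h1 h2 (funext fun f => ?_)) a
    exact (hT z f).trans (Subtype.ext (gaugeReg_regRepSum c z f).symm)

/-- The gauge action of the circle group on `C*_r(𝒢)`: the action by automorphisms which extends
the maps `T_z` on `C_c(𝒢)`. -/
def gaugeAction : Circle →* (ReducedCStar X ≃⋆ₐ[ℂ] ReducedCStar X) :=
  (existsUnique_gaugeAction c).choose

theorem gaugeAction_toReduced (z : Circle) (f : Cc X) :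
    gaugeAction c z (toReduced f) = toReduced (gaugeCc c z f) :=
  (existsUnique_gaugeAction c).choose_spec.1 z f

/-- The fixed-point algebra `C*_r(𝒢)^𝕋` of the gauge action. -/
def fixedPointAlgebra : NonUnitalStarSubalgebra ℂ (ReducedCStar X) where
  carrier := {a | ∀ z, gaugeAction c z a = a}
  add_mem' ha hb z := by rw [map_add, ha z, hb z]
  zero_mem' z := map_zero _
  mul_mem' ha hb z := by rw [map_mul, ha z, hb z]
  smul_mem' r a ha z := by rw [map_smul, ha z]
  star_mem' ha z := by rw [map_star, ha z]

end Gauge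

end Graded

end Groupoid

end EtaleGroupoid

end

/-! Two independent arguments are combined: one compares the norms of $C_c(\mathcal G_0)$ in the two
reduced algebras, the other approximates gauge-invariant elements.

Norms. A source fibre $\mathcal G_x$ is partitioned by the degree $c$. If $k\in\mathcal G_x$, the
part of degree $c(k)$ is $(\mathcal G_0)_{r(k)}\,k$, and since $(gk)(hk)^{-1}=gh^{-1}$, right
multiplication by $k$ does not change the matrix of left convolution. If $f$ vanishes off $\mathcal
G_0$, the entry $f(gh^{-1})$ is zero unless $c(g)=c(h)$. So $\lambda_x(f)$ is block diagonal, and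
its blocks are copies of the operators $\lambda_{r(k)}(f)$ of $\mathcal G_0$. This bounds the norm
over $\mathcal G$ by the norm over $\mathcal G_0$; the block of the unit, $k=x$, gives the reverse
bound. The two inequalities are `norm_regRep_extendByZero_le` and `norm_regRep_le_extendByZero`.
Extension by zero is therefore isometric, and being a $*$-homomorphism it extends to the
completions, with closed range.

Fixed points. The expectation $\int T_z\,dz$ is replaced by a finite average. A function $f\in
C_c(\mathcal G)$ lives in finitely many degrees, so averaging $T_z(f)$ over the $N$-th roots of
unity, $N$ large, leaves exactly the restriction $f_0$ of $f$ to $\mathcal G_0$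
(`exists_average_gaugeCc`). It lies in $C_c(\mathcal G_0)$ because $\mathcal G_0$ is clopen. The
average is contractive and fixes invariant $a$, so $\|a-f_0\|\le\|a-f\|$; density of $C_c(\mathcal
G)$ then makes $C_c(\mathcal G_0)$ dense in the fixed-point algebra. The support statement passes to
the closure because each evaluation $a\mapsto a(\gamma)$ is continuous. -/

noncomputable section

namespace EtaleGroupoid

variable {X : Type u} [Groupoid.{v} X] [TopologicalSpace X] [TopologicalSpace (Arr X)]

/-! ### Degree blocks of a source fibre -/

section FiberMap

variable (c : Cocycle X)

/-- Right multiplication by `k ∈ 𝒢_x`, as a map from the source fibre of `𝒢₀` over `r(k)` to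
`𝒢_x`. -/
def fiberMap {x : X} (k : Fiber x) (g : Fiber (X := DegreeZero c) k.1) : Fiber x :=
  Sigma.mk (β := fun y : X => (x ⟶ y)) g.1 (CategoryStruct.comp (obj := X) k.2 g.2.1)

/-- The factor $k$ cancels in $(gk)(hk)^{-1}$. Hence the matrix of left convolution on the block of
$k$ does not depend on $k$ except through $r(k)$. -/
theorem fiberMap_div {x : X} (k : Fiber x) (g h : Fiber (X := DegreeZero c) k.1) :
    (fiberMap c k g).div (fiberMap c k h) = DegreeZero.incl c (g.div h) := by
  have key : ∀ {a b d : X} (k : x ⟶ a) (g : a ⟶ b) (h : a ⟶ d),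
      Groupoid.inv (k ≫ h) ≫ k ≫ g = Groupoid.inv h ≫ g := by
    intro a b d k g h
    simp
  exact Arr.ext rfl rfl (heq_of_eq (key k.2 g.2.1 h.2.1))

theorem fiberMap_injective {x : X} (k : Fiber x) : Function.Injective (fiberMap c k) := by
  intro g g' h
  refine Fiber.div_left_injective (h := g) (DegreeZero.incl_injective c ?_)
  rw [← fiberMap_div, ← fiberMap_div, h]

theorem degree_fiberMap {x : X} (k : Fiber x) (g : Fiber (X := DegreeZero c) k.1) :
    c (fiberMap c k g).toArr = c k.toArr := by
  have h1 : c (fiberMap c k g).toArr = _ := c.map_comp k.2 g.2.1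
  have h2 : c ⟨k.1, g.1, g.2.1⟩ = 0 := g.2.2
  rw [h1]
  exact (congrArg (· + c k.toArr) h2).trans (zero_add _)

/-- Any $g$ of the same degree as $k$ is $(gk^{-1})k$ with $gk^{-1}$ of degree zero. The nonempty
level sets of the degree on $\mathcal G_x$ are thus copies of source fibres of $\mathcal G_0$. -/
theorem range_fiberMap {x : X} (k : Fiber x) :
    Set.range (fiberMap c k) = {g | c g.toArr = c k.toArr} := by
  ext g
  constructor
  · rintro ⟨g, rfl⟩
    exact degree_fiberMap c k g
  · intro hg
    have h0 : c (g.div k) = 0 := by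
      rw [c.map_div]
      exact sub_eq_zero.2 hg
    refine ⟨Sigma.mk (β := fun y : DegreeZero c => @Quiver.Hom (DegreeZero c) _ k.1 y) g.1
      (Subtype.mk (p := fun m : @Quiver.Hom X _ k.1 g.1 => c ⟨k.1, g.1, m⟩ = 0)
        (Groupoid.inv k.2 ≫ g.2) h0), ?_⟩
    have key : ∀ {a b : X} (k : x ⟶ a) (g : x ⟶ b), k ≫ Groupoid.inv k ≫ g = g := by
      intro a b k g
      simp
    exact Sigma.ext rfl (heq_of_eq (key k.2 g.2))

theorem fiberMap_unit_toArr (x : X) (g : Fiber (X := DegreeZero c) (Fiber.unit x).1) :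
    (fiberMap c (Fiber.unit x) g).toArr = DegreeZero.incl c g.toArr :=
  Arr.ext rfl rfl (heq_of_eq (Category.id_comp (obj := X) g.2.1))

end FiberMap

variable [IsEtale X] (c : Cocycle X)

theorem extendByZero_incl (f : Cc (DegreeZero c)) (g : Arr (DegreeZero c)) :
    (extendByZero c f).1 (DegreeZero.incl c g) = f.1 g := by
  rw [extendByZero_apply, (DegreeZero.incl_injective c).extend_apply]

theorem extendByZero_of_ne (f : Cc (DegreeZero c)) {g : Arr X} (hg : c g ≠ 0) :
    (extendByZero c f).1 g = 0 := by
  rw [extendByZero_apply, Function.extend_apply']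
  · rfl
  · intro h
    have : g ∈ Set.range (DegreeZero.incl c) := h
    rw [DegreeZero.range_incl] at this
    exact hg this

/-! ### Extension by zero preserves the reduced norm -/

section Norm

/-- Pulling back along an injection as a map of `ℓ²`-spaces. -/
def ell2Comp {ι κ : Type*} {e : κ → ι} (he : Function.Injective e) (ξ : Ell2 ι) : Ell2 κ :=
  ⟨fun i => ξ (e i), by
    change Memℓp _ 2
    rw [memlp_two_iff]
    refine ((ENNReal.tsum_comp_le_tsum_of_injective he fun i => ‖ξ i‖ₑ ^ 2).trans_lt ?_).ne
    rw [← enorm_sq_eq_tsum]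
    simp⟩

theorem tsum_extend_zero {ι κ : Type*} {e : κ → ι} (he : Function.Injective e) (ξ : κ → ℂ) :
    ∑' i, ‖Function.extend e ξ 0 i‖ₑ ^ 2 = ∑' j, ‖ξ j‖ₑ ^ 2 := by
  rw [← he.tsum_eq]
  · exact tsum_congr fun j => by rw [he.extend_apply]
  · intro i hi
    by_contra h
    refine hi ?_
    change ‖Function.extend e ξ 0 i‖ₑ ^ 2 = 0
    rw [Function.extend_apply' _ _ _ h]
    simp

/-- Extension by zero along an injection as a map of `ℓ²`-spaces. -/
def ell2Extend {ι κ : Type*} {e : κ → ι} (he : Function.Injective e) (ξ : Ell2 κ) : Ell2 ι :=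
  ⟨Function.extend e ξ 0, by
    change Memℓp _ 2
    rw [memlp_two_iff, tsum_extend_zero he, ← enorm_sq_eq_tsum]
    simp⟩

theorem ell2Comp_extend {ι κ : Type*} {e : κ → ι} (he : Function.Injective e) (ξ : Ell2 κ) :
    ell2Comp he (ell2Extend he ξ) = ξ := by
  ext i
  exact he.extend_apply _ _ _

/-- Block diagonality of $\lambda_x(f)$ for $f$ supported on $\mathcal G_0$: on the coordinates in
the block of $k$, the operator sees only the part of $\xi$ in that block and acts there as
$\lambda_{r(k)}(f)$ of $\mathcal G_0$. -/
theorem regRep_extendByZero_fiberMap (f : Cc (DegreeZero c)) {x : X} (k : Fiber x)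
    (ξ : Ell2 (Fiber x)) (g : Fiber (X := DegreeZero c) k.1) :
    regRep x (extendByZero c f) ξ (fiberMap c k g) =
      regRep (X := DegreeZero c) k.1 f (ell2Comp (fiberMap_injective c k) ξ) g := by
  refine (regRep_apply x _ ξ _).trans
    (Eq.trans ?_ (regRep_apply (X := DegreeZero c) k.1 f _ g).symm)
  rw [← (fiberMap_injective c k).tsum_eq]
  · refine tsum_congr fun h => ?_
    rw [fiberMap_div, extendByZero_incl]
    rfl
  -- A nonzero term needs $c(gk\,h^{-1})=0$, so $h$ has the degree of $k$ and lies in its block.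
  · intro h hh
    have h0 : c ((fiberMap c k g).div h) = 0 := by
      by_contra hne
      exact (left_ne_zero_of_mul hh) (extendByZero_of_ne c f hne)
    rw [c.map_div, degree_fiberMap] at h0
    rw [range_fiberMap]
    exact (sub_eq_zero.1 h0).symm

/-- Norm bounds are expressed through sums of squares in `ℝ≥0∞`, which can be split over blocks
without any summability condition; `opNorm_le_of_enorm_sq` goes back. -/
theorem enorm_apply_sq_le {ι : Type*} {A : Ell2 ι →L[ℂ] Ell2 ι} {C : ℝ≥0} (hA : ‖A‖ ≤ C)
    (ξ : Ell2 ι) : ∑' i, ‖A ξ i‖ₑ ^ 2 ≤ (C : ℝ≥0∞) ^ 2 * ∑' i, ‖ξ i‖ₑ ^ 2 := by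
  rw [← enorm_sq_eq_tsum, ← enorm_sq_eq_tsum, ← mul_pow]
  gcongr
  have h : ‖A ξ‖₊ ≤ C * ‖ξ‖₊ := A.le_of_opNorm_le hA ξ
  rw [enorm_eq_nnnorm, enorm_eq_nnnorm]
  exact_mod_cast h

theorem opNorm_le_of_enorm_sq {ι : Type*} {A : Ell2 ι →L[ℂ] Ell2 ι} {C : ℝ≥0}
    (h : ∀ ξ, ∑' i, ‖A ξ i‖ₑ ^ 2 ≤ (C : ℝ≥0∞) ^ 2 * ∑' i, ‖ξ i‖ₑ ^ 2) : ‖A‖ ≤ C := by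
  refine A.opNorm_le_bound C.2 fun ξ => ?_
  have h1 := h ξ
  rw [← enorm_sq_eq_tsum, ← enorm_sq_eq_tsum, ← mul_pow] at h1
  have h2 := (ENNReal.pow_le_pow_left_iff two_ne_zero).1 h1
  rw [enorm_eq_nnnorm, enorm_eq_nnnorm] at h2
  exact_mod_cast h2

/-- A block diagonal operator is bounded by any common bound of its blocks, and every block is some
$\lambda_{r(k)}(f)$ of $\mathcal G_0$. -/
theorem norm_regRep_extendByZero_le (f : Cc (DegreeZero c)) (x : X) :
    ‖regRep x (extendByZero c f)‖ ≤ ‖regRepSum f‖ := by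
  refine opNorm_le_of_enorm_sq (C := ‖regRepSum f‖₊) fun ξ => ?_
  -- Both sums of squares are grouped by degree, so that it suffices to compare them in each degree
  -- $n$.
  rw [← ENNReal.tsum_fiberwise _ fun g : Fiber x => c g.toArr,
    ← ENNReal.tsum_fiberwise (fun g => ‖ξ g‖ₑ ^ 2) fun g : Fiber x => c g.toArr,
    ← ENNReal.tsum_mul_left]
  refine ENNReal.tsum_le_tsum fun n => ?_
  -- A degree absent from $\mathcal G_x$ contributes nothing; otherwise any $k$ of degree $n$
  -- parametrizes the block.
  rcases Set.eq_empty_or_nonempty ((fun g : Fiber x => c g.toArr) ⁻¹' {n}) with hn | ⟨k, hk⟩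
  · have : IsEmpty ((fun g : Fiber x => c g.toArr) ⁻¹' {n}) := Set.isEmpty_coe_sort.2 hn
    simp
  · obtain rfl : c k.toArr = n := hk
    have hr : (fun g : Fiber x => c g.toArr) ⁻¹' {c k.toArr} = Set.range (fiberMap c k) :=
      (range_fiberMap c k).symm
    rw [hr, ← (Equiv.ofInjective _ (fiberMap_injective c k)).tsum_eq,
      ← (Equiv.ofInjective _ (fiberMap_injective c k)).tsum_eq]
    simp only [Equiv.ofInjective_apply, regRep_extendByZero_fiberMap]
    exact enorm_apply_sq_le (RegOps.norm_component_le (X := DegreeZero c) k.1 (regRepSum f)) _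

/-- Taking $k$ to be the unit $x$, the operator $\lambda_x(f)$ of $\mathcal G_0$ is the degree-zero
block of $\lambda_x(f)$ of $\mathcal G$, and a block has norm at most that of the whole operator.
The test vector is $\xi$ extended by zero. -/
theorem norm_regRep_le_extendByZero (f : Cc (DegreeZero c)) (x : X) :
    ‖regRep (X := DegreeZero c) x f‖ ≤ ‖regRepSum (extendByZero c f)‖ := by
  have hi := fiberMap_injective c (Fiber.unit x)
  refine opNorm_le_of_enorm_sq (C := ‖regRepSum (extendByZero c f)‖₊) fun ξ => ?_
  have h := enorm_apply_sq_le (A := regRep (X := X) x (extendByZero c f))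
    (C := ‖regRepSum (extendByZero c f)‖₊)
    (RegOps.norm_component_le (X := X) x (regRepSum (extendByZero c f))) (ell2Extend hi ξ)
  refine le_trans ?_ (h.trans_eq (congrArg _ (tsum_extend_zero hi ξ)))
  -- The coordinates outside the degree-zero block are discarded, which can only decrease the sum of
  -- squares.
  refine le_trans (le_of_eq (tsum_congr fun g => ?_))
    (ENNReal.tsum_comp_le_tsum_of_injective hi _)
  have h' := regRep_extendByZero_fiberMap c f (Fiber.unit x) (ell2Extend hi ξ) g
  have h'' := congrArg (fun η => regRep (X := DegreeZero c) x f η g) (ell2Comp_extend hi ξ)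
  exact congrArg (fun t : ℂ => ‖t‖ₑ ^ 2) (h'.trans h'').symm

theorem norm_toReduced_extendByZero (f : Cc (DegreeZero c)) :
    ‖toReduced (extendByZero c f)‖ = ‖toReduced f‖ :=
  le_antisymm (RegOps.norm_le (norm_nonneg _) fun x => norm_regRep_extendByZero_le c f x)
    (RegOps.norm_le (norm_nonneg _) fun x => norm_regRep_le_extendByZero c f x)

end Norm

end EtaleGroupoid

end

noncomputable section

namespace EtaleGroupoid

variable {X : Type u} [Groupoid.{v} X] [TopologicalSpace X] [TopologicalSpace (Arr X)]
  [IsEtale X] (c : Cocycle X)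

/-! ### The isometric embedding of the reduced algebra of the degree-zero part -/

section Embedding

theorem toReduced_mul (f₁ f₂ : Cc X) : toReduced (f₁ * f₂) = toReduced f₁ * toReduced f₂ :=
  Subtype.ext (regRepSum_mul f₁ f₂)

theorem toReduced_star (f : Cc X) : toReduced (star f) = star (toReduced f) :=
  Subtype.ext (regRepSum_star f)

/-- Degrees add: $c(gh^{-1})+c(h)=c(g)$. For $c(g)=0$ only $h$ of degree zero contribute, and these
form the fibre of $\mathcal G_0$; for $c(g)\ne0$ one of the two factors always has nonzero degree,
so every term vanishes. -/
theorem extendByZero_mul (f₁ f₂ : Cc (DegreeZero c)) :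
    extendByZero c (f₁ * f₂) = extendByZero c f₁ * extendByZero c f₂ := by
  refine Subtype.ext (funext fun g => ?_)
  change _ = ∑' h : Fiber g.src, (extendByZero c f₁).1 (g.toFiber.div h) *
    (extendByZero c f₂).1 h.toArr
  by_cases hg : c g = 0
  · obtain ⟨g, rfl⟩ : g ∈ Set.range (DegreeZero.incl c) := by rwa [DegreeZero.range_incl]
    rw [extendByZero_incl]
    have hi := fiberMap_injective c (Fiber.unit (X := X) g.src)
    have hg' : fiberMap c (Fiber.unit (X := X) g.src) g.toFiber =
        (DegreeZero.incl c g).toFiber :=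
      Sigma.ext rfl (heq_of_eq (Category.id_comp (obj := X) g.hom.1))
    refine Eq.trans ?_ (hi.tsum_eq ?_)
    · change ∑' h : Fiber g.src, f₁.1 (g.toFiber.div h) * f₂.1 h.toArr = _
      refine tsum_congr fun h => ?_
      have h1 : (DegreeZero.incl c g).toFiber.div (fiberMap c (Fiber.unit (X := X) g.src) h) =
          DegreeZero.incl c (g.toFiber.div h) :=
        hg' ▸ fiberMap_div c (Fiber.unit (X := X) g.src) g.toFiber h
      have h2 := fiberMap_unit_toArr (X := X) c g.src h
      exact congrArg₂ (· * ·)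
        ((congrArg (extendByZero c f₁).1 h1).trans (extendByZero_incl c f₁ _)).symm
        ((congrArg (extendByZero c f₂).1 h2).trans (extendByZero_incl c f₂ _)).symm
    · intro h hh
      have h0 : c h.toArr = 0 := by
        by_contra hne
        exact (right_ne_zero_of_mul hh) (extendByZero_of_ne c f₂ hne)
      exact (range_fiberMap (X := X) c (Fiber.unit (X := X) g.src)).ge (h0.trans (c.map_id _).symm)
  · rw [extendByZero_of_ne c _ hg]
    refine ((tsum_congr fun h => ?_).trans tsum_zero).symm
    by_cases h1 : c (g.toFiber.div h) = 0
    · have h2 : c h.toArr ≠ 0 := fun h2 => hg (by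
        have h3 : c g.toFiber.toArr - c h.toArr = 0 := (c.map_div g.toFiber h).symm.trans h1
        rw [h2, sub_zero] at h3
        exact h3)
      rw [extendByZero_of_ne c f₂ h2, mul_zero]
    · rw [extendByZero_of_ne c f₁ h1, zero_mul]

theorem Cocycle.map_arr_inv (g : Arr X) : c g.inv = -c g := c.map_inv g.hom

theorem extendByZero_star (f : Cc (DegreeZero c)) :
    extendByZero c (star f) = star (extendByZero c f) := by
  refine Subtype.ext (funext fun g => ?_)
  change _ = star ((extendByZero c f).1 g.inv)
  by_cases hg : c g = 0
  · obtain ⟨g, rfl⟩ : g ∈ Set.range (DegreeZero.incl c) := by rwa [DegreeZero.range_incl]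
    have h : (DegreeZero.incl c g).inv = DegreeZero.incl c g.inv := rfl
    rw [extendByZero_incl, h, extendByZero_incl]
    rfl
  · have h : c g.inv ≠ 0 := by
      rw [c.map_arr_inv]
      exact neg_ne_zero.2 hg
    rw [extendByZero_of_ne c _ hg, extendByZero_of_ne c _ h, star_zero]

/-- The extension of a multiplicative, `*`-preserving, norm-preserving linear map from `C_c(𝒢)` into a
C⋆-algebra to an isometric `*`-homomorphism on `C*_r(𝒢)`. -/
theorem exists_isometry_extend {B : Type*} [NonUnitalCStarAlgebra B] (φ : Cc X →ₗ[ℂ] B)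
    (hmul : ∀ f₁ f₂, φ (f₁ * f₂) = φ f₁ * φ f₂) (hstar : ∀ f, φ (star f) = star (φ f))
    (hnorm : ∀ f, ‖φ f‖ = ‖toReduced f‖) :
    ∃ ψ : ReducedCStar X →⋆ₙₐ[ℂ] B, Isometry ψ ∧ ∀ f, ψ (toReduced f) = φ f := by
  have hd := denseRange_toReduced (X := X)
  let L : ReducedCStar X →L[ℂ] B := φ.extendOfNorm toReduced
  have hL : ∀ f, L (toReduced f) = φ f := fun f =>
    LinearMap.extendOfNorm_eq hd ⟨1, fun f => by rw [one_mul, hnorm]⟩ f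
  -- The identities for norm, product and involution are closed conditions, so each is checked only
  -- on the dense image of $C_c(\mathcal G)$.
  have hLn : ∀ a, ‖L a‖ = ‖a‖ := fun a => by
    refine hd.induction_on a (isClosed_eq L.continuous.norm continuous_norm) fun f => ?_
    rw [hL, hnorm]
  have hLm : ∀ a b, L (a * b) = L a * L b := fun a b => by
    refine hd.induction_on₂ (p := fun a b => L (a * b) = L a * L b) (isClosed_eq ?_ ?_)
      (fun f₁ f₂ => ?_) a b
    · exact L.continuous.comp (continuous_fst.mul continuous_snd)
    · exact (L.continuous.comp continuous_fst).mul (L.continuous.comp continuous_snd)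
    · rw [← toReduced_mul, hL, hL, hL, hmul]
  have hLs : ∀ a, L (star a) = star (L a) := fun a => by
    refine hd.induction_on a (isClosed_eq (L.continuous.comp continuous_star)
      (continuous_star.comp L.continuous)) fun f => ?_
    rw [← toReduced_star, hL, hL, hstar]
  let ψ : ReducedCStar X →⋆ₙₐ[ℂ] B :=
    { toFun := L
      map_smul' := map_smul L
      map_zero' := map_zero L
      map_add' := map_add L
      map_mul' := hLm
      map_star' := hLs }
  exact ⟨ψ, AddMonoidHomClass.isometry_of_norm L hLn, hL⟩

/-- The domain is complete, so its isometric image is closed; it also contains the image of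
$C_c(\mathcal G)$ as a dense subset. -/
theorem range_eq_closure_of_isometry {B : Type*} [NonUnitalCStarAlgebra B]
    {ψ : ReducedCStar X → B} (hψ : Isometry ψ) :
    Set.range ψ = closure (Set.range fun f : Cc X => ψ (toReduced f)) := by
  refine Set.Subset.antisymm (hψ.continuous.range_subset_closure_image_dense
    denseRange_toReduced |>.trans_eq ?_) (closure_minimal ?_ hψ.isClosedEmbedding.isClosed_range)
  · rw [← Set.range_comp]
    rfl
  · rintro _ ⟨f, rfl⟩
    exact ⟨_, rfl⟩

end Embedding

/-! ### Averaging over roots of unity and the fixed-point algebra -/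

section FixedPoints

theorem continuous_gaugeAction (z : Circle) :
    Continuous (gaugeAction (X := X) c z) := (StarAlgEquiv.isometry (gaugeAction c z)).continuous

theorem norm_gaugeAction (z : Circle) (a : ReducedCStar X) : ‖gaugeAction c z a‖ = ‖a‖ :=
  StarAlgEquiv.norm_map _ _

theorem isClosed_fixedPointAlgebra :
    IsClosed (fixedPointAlgebra c : Set (ReducedCStar X)) := by
  have h : (fixedPointAlgebra c : Set (ReducedCStar X)) = ⋂ z, {a | gaugeAction c z a = a} := by
    ext a
    rw [Set.mem_iInter]
    rfl
  rw [h]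
  exact isClosed_iInter fun z => isClosed_eq (continuous_gaugeAction c z) continuous_id

theorem toReduced_extendByZero_mem (f : Cc (DegreeZero c)) :
    toReduced (extendByZero c f) ∈ fixedPointAlgebra c := fun z => by
  rw [gaugeAction_toReduced]
  congr 1
  refine Subtype.ext (funext fun g => ?_)
  rw [gaugeCc_apply]
  by_cases hg : c g = 0
  · rw [hg, zpow_zero, Circle.coe_one, one_mul]
  · rw [extendByZero_of_ne c f hg, mul_zero]

/-- Since $\mathbb Z$ is discrete, $\mathcal G_0$ is closed as well as open. Closedness is what
keeps $K\cap\mathcal G_0$ compact for compact $K$ when $\mathcal G$ is not Hausdorff, and so lets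
functions in $C_c(\mathcal G)$ be restricted to $\mathcal G_0$. -/
theorem DegreeZero.isClosedEmbedding_incl : IsClosedEmbedding (DegreeZero.incl c) where
  toIsEmbedding := (DegreeZero.isOpenEmbedding_incl c).isEmbedding
  isClosed_range := by
    rw [DegreeZero.range_incl]
    exact (isClosed_discrete {(0 : ℤ)}).preimage c.continuous_toFun

theorem IsBisectionFun.comp_incl {f : Arr X → ℂ} (hf : IsBisectionFun f) :
    IsBisectionFun (f ∘ DegreeZero.incl c) := by
  have hi := DegreeZero.isClosedEmbedding_incl c
  obtain ⟨U, hU, hUb, hUc, K, hKU, hK, hf⟩ := hf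
  have hopen := hU.preimage hi.continuous
  refine ⟨_, hopen, isBisection_of_isOpen hopen ?_ ?_,
    hUc.comp hi.continuous.continuousOn fun g hg => hg, DegreeZero.incl c ⁻¹' K,
    Set.preimage_mono hKU, hi.isCompact_preimage hK, fun g hg => hf _ hg⟩
  · intro g hg g' hg' h
    exact hi.injective (hUb.injOn_src hg hg' h)
  · intro g hg g' hg' h
    exact hi.injective (hUb.injOn_tgt hg hg' h)

theorem comp_incl_mem (f : Cc X) : f.1 ∘ DegreeZero.incl c ∈ Cc (DegreeZero c) := by
  have h : Cc X ≤ (Cc (DegreeZero c)).comap (LinearMap.funLeft ℂ ℂ (DegreeZero.incl c)) :=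
    Submodule.span_le.2 fun f hf => Submodule.subset_span (IsBisectionFun.comp_incl c hf)
  exact h f.2

/-- A continuous integer-valued map is bounded on compact sets, and $f$ is a finite combination of
functions vanishing off compact sets. The bound is strict so that $N\mid c(g)$ with $f(g)\ne0$
forces $c(g)=0$. -/
theorem exists_degree_bound (f : Cc X) : ∃ N : ℕ, ∀ g, f.1 g ≠ 0 → (c g).natAbs < N := by
  obtain ⟨f, hf⟩ := f
  induction hf using Submodule.span_induction with
  | mem f hf =>
    obtain ⟨U, -, -, -, K, -, hK, hf⟩ := hf
    obtain ⟨N, hN⟩ := (hK.image (f := fun g => (c g).natAbs)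
      ((continuous_of_discreteTopology (f := Int.natAbs)).comp c.continuous_toFun)).bddAbove
    exact ⟨N + 1, fun g hg =>
      Nat.lt_succ_of_le (hN ⟨g, by_contra fun h => hg (hf g h), rfl⟩)⟩
  | zero => exact ⟨0, fun g hg => absurd rfl hg⟩
  | add f₁ f₂ _ _ h₁ h₂ =>
    obtain ⟨N₁, h₁⟩ := h₁
    obtain ⟨N₂, h₂⟩ := h₂
    refine ⟨max N₁ N₂, fun g hg => ?_⟩
    by_cases h : f₁ g = 0
    · refine lt_max_of_lt_right (h₂ g fun h' => hg ?_)
      change f₁ g + f₂ g = 0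
      rw [h, zero_add]
      exact h'
    · exact lt_max_of_lt_left (h₁ g h)
  | smul a f _ h =>
    obtain ⟨N, h⟩ := h
    exact ⟨N, fun g hg => h g (right_ne_zero_of_mul hg)⟩

/-- For $n\neq0$ this is a geometric sum of ratio $\zeta^n$; the ratio is not $1$ because $N\mid n$
is impossible for $0<|n|<N$, and $(\zeta^n)^N=1$. -/
theorem sum_rootsOfUnity_zpow {N : ℕ} {ζ : ℂ} (hζ : IsPrimitiveRoot ζ N) {n : ℤ}
    (hn : n.natAbs < N) : ∑ j ∈ Finset.range N, (ζ ^ j) ^ n = if n = 0 then (N : ℂ) else 0 := by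
  have h : ∀ j : ℕ, (ζ ^ j) ^ n = (ζ ^ n) ^ j := fun j => by
    rw [← zpow_natCast, ← zpow_natCast, ← zpow_mul, ← zpow_mul, mul_comm]
  simp_rw [h]
  split_ifs with h0
  · simp [h0]
  · have h1 : ζ ^ n ≠ 1 := fun h1 => by
      have hd := Int.natAbs_dvd_natAbs.2 ((hζ.zpow_eq_one_iff_dvd n).1 h1)
      rw [Int.natAbs_natCast] at hd
      exact absurd (Nat.le_of_dvd (Int.natAbs_pos.2 h0) hd) (not_le.2 hn)
    rw [geom_sum_eq h1, ← h N, hζ.pow_eq_one, one_zpow, sub_self, zero_div]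

/-- The restriction of `f` to `𝒢₀` is the average of `T_z(f)` over sufficiently many roots of
unity `z`. -/
theorem exists_average_gaugeCc (f : Cc X) : ∃ (N : ℕ) (ζ : Circle) (f₀ : Cc (DegreeZero c)),
    N ≠ 0 ∧ extendByZero c f₀ = (N : ℂ)⁻¹ • ∑ j ∈ Finset.range N, gaugeCc c (ζ ^ j) f := by
  obtain ⟨N₀, hN₀⟩ := exists_degree_bound c f
  -- The bound is raised by one to make $N$ nonzero, since $f=0$ allows $N_0=0$.
  obtain ⟨N, hN, hN0⟩ : ∃ N : ℕ, (∀ g, f.1 g ≠ 0 → (c g).natAbs < N) ∧ N ≠ 0 :=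
    ⟨N₀ + 1, fun g hg => (hN₀ g hg).trans (Nat.lt_succ_self _), Nat.succ_ne_zero _⟩
  have hζ : IsPrimitiveRoot ((Circle.exp (2 * Real.pi / N) : Circle) : ℂ) N := by
    convert Complex.isPrimitiveRoot_exp N hN0 using 1
    rw [Circle.coe_exp]
    congr 1
    push_cast
    ring
  refine ⟨N, Circle.exp (2 * Real.pi / N), ⟨_, comp_incl_mem c f⟩, hN0,
    Subtype.ext (funext fun g => ?_)⟩
  have h1 : ((N : ℂ)⁻¹ • ∑ j ∈ Finset.range N,
        gaugeCc c (Circle.exp (2 * Real.pi / N) ^ j) f).1 g =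
      (N : ℂ)⁻¹ * ((∑ j ∈ Finset.range N,
        (((Circle.exp (2 * Real.pi / N) : Circle) : ℂ) ^ j) ^ c g) * f.1 g) := by
    rw [Submodule.coe_smul, Submodule.coe_sum, Pi.smul_apply, Finset.sum_apply, smul_eq_mul,
      Finset.sum_mul]
    simp only [gaugeCc_apply, Circle.coe_zpow, Circle.coe_pow]
  rw [h1]
  -- The degree bound is available only where $f(g)\ne0$; where $f(g)=0$ both sides vanish whatever
  -- the value of the sum of roots of unity.
  by_cases hfg : f.1 g = 0
  · rw [hfg, mul_zero, mul_zero]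
    by_cases hg : c g = 0
    · obtain ⟨g, rfl⟩ : g ∈ Set.range (DegreeZero.incl c) := by rwa [DegreeZero.range_incl]
      rw [extendByZero_incl]
      exact hfg
    · exact extendByZero_of_ne c _ hg
  · rw [sum_rootsOfUnity_zpow hζ (hN g hfg)]
    split_ifs with hg
    · obtain ⟨g, rfl⟩ : g ∈ Set.range (DegreeZero.incl c) := by rwa [DegreeZero.range_incl]
      rw [extendByZero_incl, inv_mul_cancel_left₀ (Nat.cast_ne_zero.2 hN0)]
      rfl
    · rw [extendByZero_of_ne c _ hg, zero_mul, mul_zero]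

/-- Averaging over the gauge action fixes $a$, sends $f$ to its restriction $f_0$ to $\mathcal G_0$,
and does not increase norms because every $T_z$ is isometric. -/
theorem exists_norm_sub_extendByZero_le {a : ReducedCStar X} (ha : a ∈ fixedPointAlgebra c)
    (f : Cc X) :
    ∃ f₀ : Cc (DegreeZero c), ‖a - toReduced (extendByZero c f₀)‖ ≤ ‖a - toReduced f‖ := by
  obtain ⟨N, ζ, f₀, hN, hf₀⟩ := exists_average_gaugeCc c f
  have hN' : (N : ℂ) ≠ 0 := Nat.cast_ne_zero.2 hN
  refine ⟨f₀, ?_⟩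
  have h : a - toReduced (extendByZero c f₀) =
      (N : ℂ)⁻¹ • ∑ j ∈ Finset.range N, gaugeAction c (ζ ^ j) (a - toReduced f) := by
    have h1 : ∀ j, gaugeAction c (ζ ^ j) (a - toReduced f) = a - toReduced (gaugeCc c (ζ ^ j) f) :=
      fun j => by rw [map_sub, gaugeAction_toReduced, ha]
    simp_rw [h1]
    rw [Finset.sum_sub_distrib, Finset.sum_const, Finset.card_range, smul_sub, hf₀, map_smul,
      map_sum, ← Nat.cast_smul_eq_nsmul ℂ, inv_smul_smul₀ hN']
  rw [h, norm_smul, norm_inv, Complex.norm_natCast]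
  refine (inv_mul_le_iff₀ (by positivity)).2 ((norm_sum_le _ _).trans_eq ?_)
  simp_rw [norm_gaugeAction]
  rw [Finset.sum_const, Finset.card_range, nsmul_eq_mul]

theorem fixedPointAlgebra_eq_closure :
    (fixedPointAlgebra c : Set (ReducedCStar X)) =
      closure (Set.range fun f : Cc (DegreeZero c) => toReduced (extendByZero c f)) := by
  refine Set.Subset.antisymm (fun a ha => ?_)
    (closure_minimal ?_ (isClosed_fixedPointAlgebra c))
  · refine Metric.mem_closure_range_iff.2 fun ε hε => ?_
    obtain ⟨f, hf⟩ := denseRange_toReduced.exists_dist_lt a hε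
    obtain ⟨f₀, hf₀⟩ := exists_norm_sub_extendByZero_le c ha f
    rw [dist_eq_norm] at hf
    exact ⟨f₀, by rw [dist_eq_norm]; exact hf₀.trans_lt hf⟩
  · rintro _ ⟨f, rfl⟩
    exact toReduced_extendByZero_mem c f

/-- Evaluation at $\gamma$ is a matrix coefficient of the component at $s(\gamma)$. Its continuity
carries vanishing at $\gamma$ from $C_c(\mathcal G_0)$ to its closure. -/
theorem continuous_toFunction_apply (γ : Arr X) :
    Continuous fun a : ReducedCStar X => toFunction a γ := by
  have h : Continuous fun a : ReducedCStar X => RegOps.component γ.src a.1 :=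
    (AddMonoidHomClass.continuous_of_bound (RegOps.component γ.src) 1 fun a => by
      rw [one_mul]
      exact RegOps.norm_component_le _ a).comp continuous_subtype_val
  exact continuous_const.inner (h.clm_apply continuous_const)

theorem support_toFunction_subset {a : ReducedCStar X} (ha : a ∈ fixedPointAlgebra c) :
    Function.support (toFunction a) ⊆ {γ | c γ = 0} := by
  intro γ hγ
  by_contra hne
  have ha' : a ∈ (fixedPointAlgebra c : Set (ReducedCStar X)) := ha
  rw [fixedPointAlgebra_eq_closure] at ha'
  refine hγ (closure_minimal (t := {a | toFunction a γ = 0}) ?_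
    (isClosed_eq (continuous_toFunction_apply γ) continuous_const) ha')
  rintro _ ⟨f, rfl⟩
  change toFunction (toReduced (extendByZero c f)) γ = 0
  rw [toFunction_toReduced]
  exact extendByZero_of_ne c f hne

end FixedPoints

end EtaleGroupoid

end

theorem mainTheorem7 {X : Type u} [CategoryTheory.Groupoid.{v} X] [TopologicalSpace X]
    [TopologicalSpace (EtaleGroupoid.Arr X)] [EtaleGroupoid.IsEtale X]
    (c : EtaleGroupoid.Cocycle X) :
    -- the fixed-point algebra is the closure of `C_c(𝒢₀)` in `C*_r(𝒢)`
    ((EtaleGroupoid.fixedPointAlgebra c : Set (EtaleGroupoid.ReducedCStar X)) =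
      closure (Set.range fun f : EtaleGroupoid.Cc (EtaleGroupoid.DegreeZero c) =>
        EtaleGroupoid.toReduced (EtaleGroupoid.extendByZero c f))) ∧
    -- it is `C*_r(𝒢₀)`, embedded in `C*_r(𝒢)` by extension of functions by zero
    (∃ ι : EtaleGroupoid.ReducedCStar (EtaleGroupoid.DegreeZero c) →⋆ₙₐ[ℂ]
        EtaleGroupoid.ReducedCStar X,
      Isometry ι ∧
      (∀ f : EtaleGroupoid.Cc (EtaleGroupoid.DegreeZero c),
        ι (EtaleGroupoid.toReduced f) =
          EtaleGroupoid.toReduced (EtaleGroupoid.extendByZero c f)) ∧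
      Set.range ι = (EtaleGroupoid.fixedPointAlgebra c : Set (EtaleGroupoid.ReducedCStar X))) ∧
    -- gauge-invariant elements are supported on `𝒢₀`
    (∀ a ∈ EtaleGroupoid.fixedPointAlgebra c,
      Function.support (EtaleGroupoid.toFunction a) ⊆ {γ | c γ = 0}) := by
  refine ⟨EtaleGroupoid.fixedPointAlgebra_eq_closure c, ?_,
    fun a ha => EtaleGroupoid.support_toFunction_subset c ha⟩
  obtain ⟨ι, hι, hf⟩ := EtaleGroupoid.exists_isometry_extend
    (EtaleGroupoid.toReduced.comp (EtaleGroupoid.extendByZero c))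
    (fun f₁ f₂ => by
      rw [LinearMap.comp_apply, EtaleGroupoid.extendByZero_mul, EtaleGroupoid.toReduced_mul]
      rfl)
    (fun f => by
      rw [LinearMap.comp_apply, EtaleGroupoid.extendByZero_star, EtaleGroupoid.toReduced_star]
      rfl)
    (EtaleGroupoid.norm_toReduced_extendByZero c)
  refine ⟨ι, hι, hf, ?_⟩
  -- Both sides are the closure of the image of $C_c(\mathcal G_0)$: the left one because $\iota$ is
  -- isometric, the right one by the averaging argument.
  rw [EtaleGroupoid.range_eq_closure_of_isometry hι, EtaleGroupoid.fixedPointAlgebra_eq_closure]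
  simp_rw [hf]
  rfl
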